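/- Let $m\ge 1$ and $a>0$. Let $\mathbf C^{(m)}$ be the complex Clifford algebra generated by $\mathbf e_1,\dots,\mathbf e_m$ with $\mathbf e_j\mathbf e_k+\mathbf e_k\mathbf e_j=-2\delta_{jk}$, with basis $\mathbf e_T$, $T\subseteq\{1,\dots,m\}$, norm $|\sum_T x_T\mathbf e_T|=(\sum_T|x_T|^2)^{1/2}$ and conjugation $\overline{\sum_T x_T\mathbf e_T}=\sum_T\overline{x_T}\,\overline{\mathbf e_T}$, where $\overline{\mathbf e_j}=-\mathbf e_j$ and $\overline{\mathbf e_{j_1}\cdots\mathbf e_{j_l}}=\overline{\mathbf e_{j_l}}\cdots\overline{\mathbf e_{j_1}}$. Write para-vectors as $x=x_0+\underline x$ with $x_0\in\mathbf R$, $\underline x=\sum_{j=1}^m x_j\mathbf e_j\in\mathbf R^m$, so that $\overline x=x_0-\underline x$, and let $S_a=\{x\in\mathbf R^{m+1}:|x_0|<a\}$. The monogenic Bergman space $A^2(S_a)$ consists of the $C^1$ functions $f:S_a\to\mathbf C^{(m)}$ with $\partial_0f+\sum_{k=1}^m\mathbf e_k\partial_kf=0$ (left-monogenic functions) and $$\|f\|_{A^2(S_a)}^2=\int_{-a}^a\int_{\mathbf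 R^m}|f(x_0+\underline x)|^2\,d\underline x\,dx_0<\infty ,$$ with the $\mathbf C^{(m)}$-valued inner product $\langle f,h\rangle=\int_{S_a}\overline{h}\,f$. For $\xi\in\mathbf R^m$ put $\chi_\pm(\xi)=\frac12\bigl(1\pm i\frac{\xi}{|\xi|}\bigr)$ and $$e(x,\xi)=e^{i\langle\underline x,\xi\rangle}\bigl(e^{-x_0|\xi|}\chi_+(\xi)+e^{x_0|\xi|}\chi_-(\xi)\bigr).$$ For a function $f$ on $S_a$ whose restriction $f|_{\mathbf R^m}$ to $x_0=0$ is in $L^2(\mathbf R^m,\mathbf C^{(m)})$, let $\mathcal Ff$ be the $L^2$ (Plancherel) Fourier transform of $f|_{\mathbf R^m}$, normalized as $\mathcal F f(\xi)=\int_{\mathbf R^m}e^{-i\langle\underline x,\xi\rangle}f(\underline x)\,d\underline x$. **Theorem.** (1) A function $f:S_a\to\mathbf C^{(m)}$ is in $A^2(S_a)$ if and only if $f|_{\mathbf R^m}\in L^2(\mathbf R^m,\mathbf C^{(m)})$ and $g=\mathcal Ff\in L^2(\mathbf R^m,\mathbf C^{(m)})$ satisfies $$\frac1{(2\pi)^m}\int_{\mathbf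 R^m}\bigl(e^{2a|\xi|}-e^{-2a|\xi|}\bigr)\frac{|g(\xi)|^2}{2|\xi|}\,d\xi<\infty$$ and $$f(x)=\frac1{(2\pi)^m}\int_{\mathbf R^m}e(x,\xi)\,g(\xi)\,d\xi\quad\text{for all }x\in S_a,$$ where the last integral converges absolutely. (2) If $f\in A^2(S_a)$ and $g=\mathcal Ff$, then $$\frac1{(2\pi)^m}\int_{\mathbf R^m}\bigl(e^{2a|\xi|}-e^{-2a|\xi|}\bigr)\frac{|g(\xi)|^2}{2|\xi|}\,d\xi=\|f\|_{A^2(S_a)}^2 .$$ (3) For $w,x\in S_a$ the integral $$B(w,\overline x)=\frac1{(2\pi)^m}\int_{\mathbf R^m}e(w+\overline x,\xi)\,\frac{2|\xi|}{e^{2a|\xi|}-e^{-2a|\xi|}}\,d\xi$$ converges absolutely, and $B$ is the Bergman (reproducing) kernel of $A^2(S_a)$: for every $x\in S_a$ one has $B(\cdot,\overline x)\in A^2(S_a)$ and $$f(x)=\int_{S_a}\overline{B(w,\overline x)}\,f(w)\,dw\quad\text{for all }f\in A^2(S_a),$$ where the integral converges absolutely, and $B$ is the only function on $S_a\times S_a$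 with these properties. -/

import Mathlib

open MeasureTheory FourierTransform
open scoped symmDiff

noncomputable section

/-! ## The complex Clifford algebra with its standard basis, product, conjugation and norm -/

/-- The complex Clifford algebra `C^(m)`: an element `x = ∑_T x_T e_T` is its family of complex
coordinates `x_T`, with `T` running over the subsets of `{1, …, m}` (here `Fin m`).
It carries the Hermitian norm `|x| = (∑_T |x_T|²)^(1/2)`. -/
def Cliff (m : ℕ) : Type := EuclideanSpace ℂ (Finset (Fin m))

namespace Cliff

variable {m : ℕ}

instance : NormedAddCommGroup (Cliff m) :=
  inferInstanceAs (NormedAddCommGroup (EuclideanSpace ℂ (Finset (Fin m))))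

instance : InnerProductSpace ℂ (Cliff m) :=
  inferInstanceAs (InnerProductSpace ℂ (EuclideanSpace ℂ (Finset (Fin m))))

instance : CompleteSpace (Cliff m) :=
  inferInstanceAs (CompleteSpace (EuclideanSpace ℂ (Finset (Fin m))))

instance : FiniteDimensional ℂ (Cliff m) :=
  inferInstanceAs (FiniteDimensional ℂ (EuclideanSpace ℂ (Finset (Fin m))))

/-- The coordinate `x_T`. -/
def coeff (x : Cliff m) (T : Finset (Fin m)) : ℂ :=
  WithLp.ofLp (p := 2) (V := Finset (Fin m) → ℂ) x T

/-- The element `∑_T c_T e_T`. -/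
def mk (c : Finset (Fin m) → ℂ) : Cliff m := WithLp.toLp 2 c

@[simp] theorem coeff_mk (c : Finset (Fin m) → ℂ) (T : Finset (Fin m)) :
    (mk c).coeff T = c T := rfl

@[ext] theorem ext {x y : Cliff m} (h : ∀ T, x.coeff T = y.coeff T) : x = y :=
  PiLp.ext h

@[simp] theorem coeff_add (x y : Cliff m) (T : Finset (Fin m)) :
    (x + y).coeff T = x.coeff T + y.coeff T := rfl

@[simp] theorem coeff_neg (x : Cliff m) (T : Finset (Fin m)) : (-x).coeff T = -x.coeff T := rfl

@[simp] theorem coeff_zero (T : Finset (Fin m)) : (0 : Cliff m).coeff T = 0 := rfl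

@[simp] theorem coeff_smul (c : ℂ) (x : Cliff m) (T : Finset (Fin m)) :
    (c • x).coeff T = c * x.coeff T := rfl

theorem norm_sq (x : Cliff m) : ‖x‖ ^ 2 = ∑ T, ‖x.coeff T‖ ^ 2 :=
  EuclideanSpace.norm_sq_eq (𝕜 := ℂ) (n := Finset (Fin m)) x

/-- The sign in `e_A e_B = ± e_{A ∆ B}`: every pair `i ∈ A`, `j ∈ B` with `j < i` has to be
interchanged (`e_i e_j = - e_j e_i`), and every common index contributes `e_i² = -1`. -/
def sign (A B : Finset (Fin m)) : ℂ := ∏ i ∈ A, ∏ j ∈ B, if j ≤ i then -1 else 1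

theorem prod_symmDiff_of_sq (f : Fin m → ℂ) (hf : ∀ i, f i * f i = 1) (A B : Finset (Fin m)) :
    ∏ i ∈ A ∆ B, f i = (∏ i ∈ A, f i) * ∏ i ∈ B, f i := by
  have hA := Finset.prod_sdiff (f := f) (Finset.inter_subset_left (s₁ := A) (s₂ := B))
  have hB := Finset.prod_sdiff (f := f) (Finset.inter_subset_right (s₁ := A) (s₂ := B))
  have hI : (∏ i ∈ A ∩ B, f i) * ∏ i ∈ A ∩ B, f i = 1 := by
    rw [← Finset.prod_mul_distrib]; exact Finset.prod_eq_one fun i _ => hf i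
  rw [Finset.symmDiff_def, Finset.prod_union disjoint_sdiff_sdiff, ← hA, ← hB,
    Finset.sdiff_inter_self_left, Finset.sdiff_inter_self_right]
  linear_combination (-(∏ i ∈ A \ B, f i) * ∏ i ∈ B \ A, f i) * hI

theorem sign_symmDiff_left (A B C : Finset (Fin m)) :
    sign (A ∆ B) C = sign A C * sign B C := by
  refine prod_symmDiff_of_sq _ (fun i => ?_) A B
  rw [← Finset.prod_mul_distrib]
  exact Finset.prod_eq_one fun j _ => by split_ifs <;> norm_num

theorem sign_symmDiff_right (A B C : Finset (Fin m)) :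
    sign A (B ∆ C) = sign A B * sign A C := by
  unfold sign
  rw [← Finset.prod_mul_distrib]
  refine Finset.prod_congr rfl fun i _ => prod_symmDiff_of_sq _ (fun j => ?_) B C
  split_ifs <;> norm_num

theorem sign_mul_self (A B : Finset (Fin m)) : sign A B * sign A B = 1 := by
  rw [← sign_symmDiff_left, symmDiff_self]; simp [sign]

theorem conj_sign (A B : Finset (Fin m)) : (starRingEnd ℂ) (sign A B) = sign A B := by
  simp only [sign, map_prod]
  refine Finset.prod_congr rfl fun i _ => Finset.prod_congr rfl fun j _ => ?_
  split_ifs <;> simp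

/-- The product determined by bilinearity and `e_A e_B = sign A B • e_{A ∆ B}`. -/
instance : Mul (Cliff m) where
  mul x y := mk fun C => ∑ A, sign A (A ∆ C) * x.coeff A * y.coeff (A ∆ C)

instance : One (Cliff m) where
  one := mk fun C => if C = ∅ then 1 else 0

theorem coeff_mul (x y : Cliff m) (C : Finset (Fin m)) :
    (x * y).coeff C = ∑ A, sign A (A ∆ C) * x.coeff A * y.coeff (A ∆ C) := rfl

theorem coeff_one (C : Finset (Fin m)) : (1 : Cliff m).coeff C = if C = ∅ then 1 else 0 := rfl

protected theorem mul_assoc' (x y z : Cliff m) : x * y * z = x * (y * z) := by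
  ext C
  simp only [coeff_mul, Finset.mul_sum, Finset.sum_mul]
  rw [Finset.sum_comm]
  refine Finset.sum_congr rfl fun A _ => ?_
  refine Fintype.sum_equiv (Equiv.ofBijective (fun D => A ∆ D)
    (Function.Involutive.bijective fun D => symmDiff_symmDiff_cancel_left A D)) _ _ fun D => ?_
  have h1 : A ∆ D ∆ (A ∆ C) = D ∆ C := by
    rw [symmDiff_symmDiff_symmDiff_comm]; simp
  simp only [Equiv.ofBijective_apply, h1]
  have h2 : sign D (D ∆ C) * sign A (A ∆ D) = sign A (A ∆ C) * sign (A ∆ D) (D ∆ C) := by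
    simp only [sign_symmDiff_left, sign_symmDiff_right]
    linear_combination (-(sign A A * sign A D * sign D D * sign D C)) * sign_mul_self A C
  linear_combination (x.coeff A * y.coeff (A ∆ D) * z.coeff (D ∆ C)) * h2

instance : Ring (Cliff m) :=
  { (inferInstance : AddCommGroup (Cliff m)) with
    mul := (· * ·)
    one := 1
    mul_assoc := Cliff.mul_assoc'
    one_mul := fun x => by
      ext C
      rw [coeff_mul, Finset.sum_eq_single ∅]
      · have : ∅ ∆ C = C := bot_symmDiff C
        simp [coeff_one, sign, this]
      · intro A _ hA; simp [coeff_one, hA]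
      · simp
    mul_one := fun x => by
      ext C
      rw [coeff_mul, Finset.sum_eq_single C]
      · simp [coeff_one, sign]
      · intro A _ hA; simp [coeff_one, hA]
      · simp
    zero_mul := fun x => by ext C; simp [coeff_mul]
    mul_zero := fun x => by ext C; simp [coeff_mul]
    left_distrib := fun x y z => by
      ext C; simp [coeff_mul, mul_add, Finset.sum_add_distrib]
    right_distrib := fun x y z => by
      ext C; simp [coeff_mul, mul_add, add_mul, Finset.sum_add_distrib] }

instance : Algebra ℂ (Cliff m) :=
  Algebra.ofModule
    (fun c x y => by
      ext C; simp only [coeff_mul, coeff_smul, Finset.mul_sum]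
      exact Finset.sum_congr rfl fun A _ => by ring)
    (fun c x y => by
      ext C; simp only [coeff_mul, coeff_smul, Finset.mul_sum]
      exact Finset.sum_congr rfl fun A _ => by ring)

/-- The basis element `e_T`. -/
def basisElt (T : Finset (Fin m)) : Cliff m := mk fun C => if C = T then 1 else 0

/-- The generator `e_j`. -/
def e (j : Fin m) : Cliff m := basisElt {j}

theorem basisElt_mul (A B : Finset (Fin m)) :
    basisElt A * basisElt B = sign A B • basisElt (A ∆ B) := by
  ext C
  have h : A ∆ C = B ↔ C = A ∆ B := by
    constructor
    · rintro rfl; simp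
    · rintro rfl; simp
  rw [coeff_mul, Finset.sum_eq_single A]
  · by_cases hC : C = A ∆ B
    · subst hC; simp [basisElt]
    · simp [basisElt, hC, h]
  · intro D _ hD; simp [basisElt, hD]
  · simp

/-- The defining relations `e_j e_k + e_k e_j = -2 δ_{jk}`. -/
theorem e_mul_e_add (j k : Fin m) :
    e j * e k + e k * e j = if j = k then (-2 : ℂ) • (1 : Cliff m) else 0 := by
  have h0 : (basisElt ∅ : Cliff m) = 1 := rfl
  simp only [e, basisElt_mul]
  split_ifs with h
  · subst h
    rw [← add_smul]
    simp only [symmDiff_self, Finset.bot_eq_empty, h0]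
    congr 1
    simp [sign]; norm_num
  · rw [symmDiff_comm ({k} : Finset (Fin m)) {j}, ← add_smul]
    have : sign {j} {k} + sign {k} {j} = 0 := by
      rcases lt_or_gt_of_ne h with h | h <;> simp [sign, h.le, h.not_ge]
    rw [this, zero_smul]

/-- `e_T` is the product of the generators `e_j`, `j ∈ T`, in increasing order: one more
generator, smaller than those already present, goes in front. -/
theorem e_mul_basisElt (j : Fin m) (T : Finset (Fin m)) (h : ∀ k ∈ T, j < k) :
    e j * basisElt T = basisElt (insert j T) := by
  have hj : j ∉ T := fun hT => lt_irrefl _ (h j hT)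
  have h1 : sign {j} T = 1 := by
    simp only [sign, Finset.prod_singleton]
    exact Finset.prod_eq_one fun k hk => by simp [(h k hk).not_ge]
  rw [e, basisElt_mul, h1, one_smul,
    Finset.symmDiff_eq_union (Finset.disjoint_singleton_left.2 hj), Finset.insert_eq]

/-- Clifford conjugation `x̄ = ∑_T conj(x_T) ē_T`. It reverses products and sends `e_j` to `-e_j`;
since `e_T e_T = sign T T = ±1`, this means `ē_T = e_T⁻¹ = sign T T • e_T`. -/
instance : Star (Cliff m) where
  star x := mk fun T => sign T T * (starRingEnd ℂ) (x.coeff T)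

theorem coeff_star (x : Cliff m) (T : Finset (Fin m)) :
    (star x).coeff T = sign T T * (starRingEnd ℂ) (x.coeff T) := rfl

instance : StarRing (Cliff m) where
  star_involutive x := by
    ext T
    simp only [coeff_star, map_mul, conj_sign, Complex.conj_conj, ← mul_assoc, sign_mul_self,
      one_mul]
  star_mul x y := by
    ext C
    simp only [coeff_star, coeff_mul, map_sum, map_mul, conj_sign, Finset.mul_sum]
    refine Fintype.sum_equiv (Equiv.ofBijective (fun D => D ∆ C)
      (Function.Involutive.bijective fun D => symmDiff_symmDiff_cancel_right C D)) _ _ fun A => ?_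
    simp only [Equiv.ofBijective_apply, symmDiff_symmDiff_cancel_right]
    simp only [sign_symmDiff_left, sign_symmDiff_right]
    linear_combination (-(sign A A * sign A C * sign C C * (starRingEnd ℂ) (x.coeff A)
      * (starRingEnd ℂ) (y.coeff (A ∆ C)))) *
        (sign_mul_self A A + sign A A * sign A A * sign_mul_self C A)
  star_add x y := by ext T; simp [coeff_star, mul_add]

theorem star_e (j : Fin m) : star (e j) = -e j := by
  ext T
  by_cases h : T = {j}
  · subst h; simp [coeff_star, e, basisElt, sign]
  · simp [coeff_star, e, basisElt, h]

/-- `Sc(x̄ x) = |x|²`. -/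
theorem coeff_star_mul_self (x : Cliff m) : (star x * x).coeff ∅ = ((‖x‖ ^ 2 : ℝ) : ℂ) := by
  rw [norm_sq, coeff_mul]
  push_cast
  refine Finset.sum_congr rfl fun T _ => ?_
  have : T ∆ ∅ = T := symmDiff_bot T
  rw [this, coeff_star, ← mul_assoc, sign_mul_self, one_mul, mul_comm, Complex.mul_conj,
    Complex.normSq_eq_norm_sq]
  push_cast; rfl

/-- The vector `ξ = ξ_1 e_1 + ⋯ + ξ_m e_m` as an element of the Clifford algebra. -/
def vec (ξ : EuclideanSpace ℝ (Fin m)) : Cliff m := ∑ j, (ξ j : ℂ) • e j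

end Cliff

/-! ## Para-vectors, strips and left-monogenic functions -/

/-- The space `R^{m+1}` of para-vectors `x = x_0 + x̲`, as pairs `(x_0, x̲)`, with Lebesgue
measure (the product measure). -/
abbrev ParaVec (m : ℕ) : Type := ℝ × EuclideanSpace ℝ (Fin m)

/-- The conjugate `x̄ = x_0 - x̲` of a para-vector. -/
def ParaVec.conj {m : ℕ} (x : ParaVec m) : ParaVec m := (x.1, -x.2)

/-- The strip `S_a = {x : |x_0| < a}`. -/
def strip (m : ℕ) (a : ℝ) : Set (ParaVec m) := {x | |x.1| < a}

/-- `D F = ∑_{k=0}^m e_k ∂_k F`, with `e_0 = 1`. -/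
def diracOp {m : ℕ} (F : ParaVec m → Cliff m) (x : ParaVec m) : Cliff m :=
  fderiv ℝ F x (1, 0) + ∑ k, Cliff.e k * fderiv ℝ F x (0, EuclideanSpace.single k 1)

/-- `F` is continuously differentiable on the open set `Ω` and `D F = 0` there. -/
def LeftMonogenicOn {m : ℕ} (F : ParaVec m → Cliff m) (Ω : Set (ParaVec m)) : Prop :=
  ContDiffOn ℝ 1 F Ω ∧ ∀ x ∈ Ω, diracOp F x = 0

/-- Membership in the monogenic Bergman space `A²(S_a, C^(m))`; only the values of `f` on the
strip matter. -/
def MemBergman {m : ℕ} (a : ℝ) (f : ParaVec m → Cliff m) : Prop :=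
  LeftMonogenicOn f (strip m a) ∧ IntegrableOn (fun x => ‖f x‖ ^ 2) (strip m a) volume

/-- `‖f‖²` in `A²(S_a, C^(m))`. -/
def bergmanNormSq {m : ℕ} (a : ℝ) (f : ParaVec m → Cliff m) : ℝ :=
  ∫ x in strip m a, ‖f x‖ ^ 2

/-- The function `K`, with `K w x` standing for `B(w, x̄)`, is a reproducing kernel of
`A²(S_a, C^(m))` for the Clifford-valued inner product `⟨f, h⟩ = ∫_{S_a} h̄ f`: for each `x` in the
strip, `K(·, x)` is in the space, and `f(x) = ⟨f, K(·, x)⟩` for all `f` in the space. -/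
def IsBergmanKernel {m : ℕ} (a : ℝ) (K : ParaVec m → ParaVec m → Cliff m) : Prop :=
  ∀ x ∈ strip m a, MemBergman a (fun w => K w x) ∧
    ∀ f : ParaVec m → Cliff m, MemBergman a f →
      IntegrableOn (fun w => star (K w x) * f w) (strip m a) volume ∧
      f x = ∫ w in strip m a, star (K w x) * f w

/-! ## The Fourier transform and the monogenic exponential -/

/-- `u` is in `L²(R^m, C^(m))` and `g` is (a representative of) its Fourier transform, in the
normalization `∫ e^{-i⟨x,ξ⟩} u(x) dx` extended to `L²` by Plancherel's theorem. Mathlib's `𝓕` is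
the transform with kernel `e^{-2πi⟨x,ξ⟩}`, so it is evaluated at `ξ / (2π)`. -/
def IsFourierL2 {m : ℕ} (u g : EuclideanSpace ℝ (Fin m) → Cliff m) : Prop :=
  ∃ hu : MemLp u 2 (volume : Measure (EuclideanSpace ℝ (Fin m))),
    g =ᵐ[volume] fun ξ =>
      (𝓕 (hu.toLp u) : Lp (Cliff m) 2 (volume : Measure (EuclideanSpace ℝ (Fin m)))) ((2 * Real.pi)⁻¹ • ξ)

/-- `χ_±(ξ) = (1 ± i ξ/|ξ|)/2`, with the sign `s = ±1`. -/
def chi {m : ℕ} (s : ℝ) (ξ : EuclideanSpace ℝ (Fin m)) : Cliff m :=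
  (1 / 2 : ℂ) • (1 + ((s : ℂ) * Complex.I / (‖ξ‖ : ℂ)) • Cliff.vec ξ)

/-- `e^±(x, ξ) = e^{i⟨x̲,ξ⟩} e^{∓ x_0 |ξ|} χ_±(ξ)`, with the sign `s = ±1`. -/
def monoExpSign {m : ℕ} (s : ℝ) (x : ParaVec m) (ξ : EuclideanSpace ℝ (Fin m)) : Cliff m :=
  (Complex.exp (Complex.I * (inner ℝ x.2 ξ : ℝ)) * Complex.exp (-(s * x.1 * ‖ξ‖ : ℝ))) • chi s ξ

/-- The monogenic exponential `e(x, ξ) = e^+(x, ξ) + e^-(x, ξ)`. -/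
def monoExp {m : ℕ} (x : ParaVec m) (ξ : EuclideanSpace ℝ (Fin m)) : Cliff m :=
  monoExpSign 1 x ξ + monoExpSign (-1) x ξ

/-- The weight `(e^{2a|ξ|} - e^{-2a|ξ|}) / (2|ξ|)` (its value at `ξ = 0` is irrelevant). -/
def bergmanWeight {m : ℕ} (a : ℝ) (ξ : EuclideanSpace ℝ (Fin m)) : ℝ :=
  (Real.exp (2 * a * ‖ξ‖) - Real.exp (-(2 * a * ‖ξ‖))) / (2 * ‖ξ‖)

/-- The integrand `e(w + x̄, ξ) · 2|ξ| / (e^{2a|ξ|} - e^{-2a|ξ|})`. -/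
def bergmanKernelIntegrand {m : ℕ} (a : ℝ) (w x : ParaVec m) (ξ : EuclideanSpace ℝ (Fin m)) :
    Cliff m :=
  (2 * ‖ξ‖ / (Real.exp (2 * a * ‖ξ‖) - Real.exp (-(2 * a * ‖ξ‖)))) • monoExp (w + x.conj) ξ

/-- `B(w, x̄) = (2π)^{-m} ∫ e(w + x̄, ξ) · 2|ξ| / (e^{2a|ξ|} - e^{-2a|ξ|}) dξ`. -/
def bergmanKernel {m : ℕ} (a : ℝ) (w x : ParaVec m) : Cliff m :=
  (((2 * Real.pi) ^ m)⁻¹ : ℝ) • ∫ ξ, bergmanKernelIntegrand a w x ξ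

end

/-! For fixed ξ ≠ 0 the elements χ_±(ξ) are complementary self-adjoint idempotents, and iξχ_± =
±|ξ|χ_±. Hence e(x,ξ)c is left-monogenic in x, e(x,ξ)e(y,ξ) = e(x+y,ξ), and left multiplication by
e(x̄,ξ) is the adjoint of left multiplication by e(x,ξ). So |e(t,ξ)v|² is a combination of
e^{∓2t|ξ|}, and its integral over |t| < a is exactly the weight times |v|²
(`setIntegral_inner_monoExp_mul`). Plancherel on each slice x_0 = t and Tonelli turn this into the
norm identity for synthesized functions (`lintegral_strip_norm_sq`) and into its polarized form
(`MemWeighted.integral_inner_synth`).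

The substantial direction is that every Bergman function is synthesized
(`MemBergman.exists_eq_synth`). If F_t is the transform of the slice f(t,·), it must be shown that
e(-t,ξ)F_t(ξ) does not depend on t. This is Cauchy's theorem: for H and f in the Bergman space the
pairing ∫⟨H(-t,y), f(t,y)⟩dy is constant in t (`MemBergman.integral_inner_slice_eq`). Taking for H
the functions synthesized from compactly supported spectra φ(ξ)c tests e(-t,ξ)F_t(ξ) against every
φ. The common value is the spectrum g, and the norm identity, valid in [0,∞], shows that g has
finite weighted norm.

For the kernel, w ↦ B(w,x̄)c has spectrum e(x̄,ξ)c divided by the weight. In the polarized identity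
the weight cancels and the synthesis integral for f(x) remains. Uniqueness is formal: two
reproducing kernels reproduce each other. -/

noncomputable section

/-! ### Fourier transform on L² in the normalization without 2π in the exponent. -/

section Fourier

open scoped SchwartzMap ENNReal

/-- On `L¹ ∩ L²` the `L²` inverse Fourier transform is given by the inverse Fourier integral. -/
theorem fourierInv_toLp_ae_eq {V F : Type*} [NormedAddCommGroup V] [InnerProductSpace ℝ V]
    [FiniteDimensional ℝ V] [MeasurableSpace V] [BorelSpace V] [NormedAddCommGroup F]
    [InnerProductSpace ℂ F] [CompleteSpace F] {g : V → F} (hg : Integrable g)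
    (hg2 : MemLp g 2 volume) :
    ((𝓕⁻ (hg2.toLp g) : Lp F 2 (volume : Measure V)) : V → F) =ᵐ[volume] 𝓕⁻ g := by
  have hcont : Continuous (𝓕⁻ g) :=
    VectorFourier.fourierIntegral_continuous (L := -innerₗ V) Real.continuous_fourierChar
      (by simpa using! continuous_inner.neg) hg
  refine ae_eq_of_integral_contDiff_smul_eq
    ((Lp.memLp _).locallyIntegrable (by norm_num)) hcont.locallyIntegrable fun φ hφ hφc => ?_
  have hφ' : ContDiff ℝ (⊤ : ℕ∞) (fun x => (φ x : ℂ)) := Complex.ofRealCLM.contDiff.comp hφ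
  have hφc' : HasCompactSupport (fun x => (φ x : ℂ)) := hφc.comp_left Complex.ofReal_zero
  set ψ : 𝓢(V, ℂ) := hφc'.toSchwartzMap hφ'
  have hψ : ∀ x, ψ x = (φ x : ℂ) := fun x => rfl
  -- The L² transform agrees with the distributional one, so pairing with ψ moves 𝓕⁻ onto ψ; since g
  -- is integrable, Fubini (`h3`) moves it back onto g as an integral.
  have h1 := congrArg (fun T => T ψ) (Lp.fourierInv_toTemperedDistribution_eq (hg2.toLp g))
  simp only [TemperedDistribution.fourierInv_apply, Lp.toTemperedDistribution_apply] at h1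
  have h2 : ∫ x, (𝓕⁻ ψ) x • (hg2.toLp g) x = ∫ x, (𝓕⁻ ψ) x • g x :=
    integral_congr_ae (by filter_upwards [hg2.coeFn_toLp] with x hx; rw [hx])
  have h3 : ∫ x, (𝓕⁻ ψ) x • g x = ∫ x, ψ x • (𝓕⁻ g) x := by
    have := VectorFourier.integral_bilin_fourierIntegral_eq_flip (ContinuousLinearMap.lsmul ℂ ℂ)
      (L := -innerₗ V) (μ := volume) (ν := volume) (f := ψ) (g := g) Real.continuous_fourierChar
      (by simpa using! continuous_inner.neg) ψ.integrable hg
    simp only [ContinuousLinearMap.lsmul_apply] at this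
    rw [SchwartzMap.fourierInv_coe]
    convert! this using 3 with x
    rw [Real.fourierInv_eq]
    simp [VectorFourier.fourierIntegral, real_inner_comm]
  rw [h2, h3] at h1
  simp only [hψ, Complex.coe_smul] at h1
  exact h1.symm

variable {m : ℕ}

theorem integral_comp_two_pi_inv_smul {F : Type*} [NormedAddCommGroup F] [NormedSpace ℝ F]
    (f : EuclideanSpace ℝ (Fin m) → F) :
    ∫ ξ, f ((2 * Real.pi)⁻¹ • ξ) = ((2 * Real.pi) ^ m) • ∫ ξ, f ξ := by
  rw [Measure.integral_comp_smul]
  simp only [finrank_euclideanSpace, Fintype.card_fin, inv_pow, inv_inv]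
  rw [abs_of_pos (by positivity)]

theorem quasiMeasurePreserving_smul_euclidean {c : ℝ} (hc : c ≠ 0) :
    Measure.QuasiMeasurePreserving (fun ξ : EuclideanSpace ℝ (Fin m) => c • ξ) volume volume := by
  refine ⟨measurable_const_smul c, ?_⟩
  rw [Measure.map_addHaar_smul _ hc]
  exact Measure.smul_absolutelyContinuous

theorem memLp_comp_const_smul {F : Type*} [NormedAddCommGroup F] {c : ℝ} (hc : c ≠ 0)
    {g : EuclideanSpace ℝ (Fin m) → F} {p : ℝ≥0∞} (hg : MemLp g p volume) :
    MemLp (fun ξ => g (c • ξ)) p volume := by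
  refine MemLp.comp_of_map (f := fun ξ => c • ξ) ?_ (measurable_const_smul c).aemeasurable
  rw [Measure.map_addHaar_smul _ hc]
  exact hg.smul_measure ENNReal.ofReal_ne_top

theorem two_pi_inv_ne_zero : (2 * Real.pi)⁻¹ ≠ 0 := by positivity

/-- The synthesis operator `g ↦ (2π)^{-m} ∫ e^{i⟨y,ξ⟩} g(ξ) dξ`, inverse to the Fourier
transform. -/
def fourierSynth (g : EuclideanSpace ℝ (Fin m) → Cliff m) (y : EuclideanSpace ℝ (Fin m)) :
    Cliff m :=
  (((2 * Real.pi) ^ m)⁻¹ : ℝ) • ∫ ξ, Complex.exp (Complex.I * (inner ℝ y ξ : ℝ)) • g ξ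

/-- The substitution ξ ↦ 2πξ passes to the kernel e^{2πi⟨y,ξ⟩}, and its Jacobian absorbs the factor
(2π)^{-m}. -/
theorem fourierSynth_eq (g : EuclideanSpace ℝ (Fin m) → Cliff m) :
    fourierSynth g = 𝓕⁻ (fun ξ => g ((2 * Real.pi) • ξ)) := by
  have h0 : (2 * Real.pi) ≠ 0 := by positivity
  funext y
  rw [Real.fourierInv_eq', fourierSynth, inv_smul_eq_iff₀ (by positivity),
    ← integral_comp_two_pi_inv_smul]
  refine integral_congr_ae (.of_forall fun ξ => ?_)
  simp only [smul_smul, mul_inv_cancel₀ h0, one_smul, real_inner_smul_left]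
  congr 2
  push_cast
  rw [real_inner_comm]
  have : (Real.pi : ℂ) ≠ 0 := by exact_mod_cast Real.pi_ne_zero
  field_simp

namespace IsFourierL2

variable {u v g h : EuclideanSpace ℝ (Fin m) → Cliff m}

theorem exists_of_memLp (hu : MemLp u 2 volume) : ∃ g, IsFourierL2 u g :=
  ⟨_, hu, ae_eq_rfl⟩

theorem memLp_left (h : IsFourierL2 u g) : MemLp u 2 volume := h.1

theorem memLp_right (h : IsFourierL2 u g) : MemLp g 2 volume := by
  obtain ⟨hu, hg⟩ := h
  exact (memLp_congr_ae hg).2 (memLp_comp_const_smul two_pi_inv_ne_zero (Lp.memLp _))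

theorem congr_right (hu : IsFourierL2 u g) (hgh : g =ᵐ[volume] h) : IsFourierL2 u h :=
  ⟨hu.1, hgh.symm.trans hu.2⟩

theorem ae_eq_right (hu : IsFourierL2 u g) (hu' : IsFourierL2 u h) : g =ᵐ[volume] h :=
  hu.2.trans hu'.2.symm

/-- Injectivity of the L² transform. Composing with ξ ↦ 2πξ first undoes the rescaling built into
`IsFourierL2`. -/
theorem ae_eq_left (hu : IsFourierL2 u g) (hv : IsFourierL2 v g) : u =ᵐ[volume] v := by
  obtain ⟨hu, hg⟩ := hu
  obtain ⟨hv, hg'⟩ := hv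
  have h1 := (quasiMeasurePreserving_smul_euclidean (m := m) (c := 2 * Real.pi)
    (by positivity)).ae_eq_comp (hg.symm.trans hg')
  have h2 : (𝓕 (hu.toLp u) : Lp (Cliff m) 2 (volume : Measure (EuclideanSpace ℝ (Fin m)))) =
      𝓕 (hv.toLp v) := by
    refine Lp.ext ?_
    filter_upwards [h1] with ξ hξ
    have h0 : (2 * Real.pi)⁻¹ * (2 * Real.pi) = 1 := inv_mul_cancel₀ (by positivity)
    simpa only [Function.comp_apply, smul_smul, h0, one_smul] using hξ
  have h3 := congrArg (fun w => 𝓕⁻ w) h2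
  simp only [FourierTransform.fourierInv_fourier_eq] at h3
  exact (MemLp.toLp_eq_toLp_iff hu hv).1 h3

/-- Parseval's identity. -/
theorem integral_inner (hu : IsFourierL2 u g) (hv : IsFourierL2 v h) :
    ∫ y, inner ℂ (u y) (v y) = (((2 * Real.pi) ^ m)⁻¹ : ℝ) • ∫ ξ, inner ℂ (g ξ) (h ξ) := by
  obtain ⟨hu, hg⟩ := hu
  obtain ⟨hv, hh⟩ := hv
  rw [eq_inv_smul_iff₀ (by positivity)]
  have h1 := Lp.inner_fourier_eq (hu.toLp u) (hv.toLp v)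
  rw [L2.inner_def, L2.inner_def] at h1
  have h2 : ∫ y, inner ℂ ((hu.toLp u) y) ((hv.toLp v) y) = ∫ y, inner ℂ (u y) (v y) :=
    integral_congr_ae (by
      filter_upwards [hu.coeFn_toLp, hv.coeFn_toLp] with y h1 h2; rw [h1, h2])
  rw [← h2, ← h1, ← integral_comp_two_pi_inv_smul]
  exact integral_congr_ae (by filter_upwards [hg, hh] with ξ h1 h2; rw [h1, h2])

/-- This links pointwise formulas to Plancherel: on L¹ ∩ L² the absolutely convergent synthesis
integral is the L² inverse transform. -/
theorem fourierSynth (hg : Integrable g) (hg2 : MemLp g 2 volume) :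
    IsFourierL2 (fourierSynth g) g := by
  have h0 : (2 * Real.pi) ≠ 0 := by positivity
  have h1 : Integrable (fun ξ => g ((2 * Real.pi) • ξ)) := hg.comp_smul h0
  have h2 : MemLp (fun ξ => g ((2 * Real.pi) • ξ)) 2 volume := memLp_comp_const_smul h0 hg2
  have h3 := fourierInv_toLp_ae_eq h1 h2
  rw [← fourierSynth_eq] at h3
  have hu : MemLp (_root_.fourierSynth g) 2 volume := (memLp_congr_ae h3).1 (Lp.memLp _)
  refine ⟨hu, ?_⟩
  have h4 : hu.toLp _ = 𝓕⁻ (h2.toLp _) := Lp.ext (hu.coeFn_toLp.trans h3.symm)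
  rw [h4, FourierTransform.fourier_fourierInv_eq]
  have h5 := (quasiMeasurePreserving_smul_euclidean (m := m) two_pi_inv_ne_zero).ae_eq_comp
    h2.coeFn_toLp
  filter_upwards [h5] with ξ hξ
  simp only [Function.comp_apply, smul_smul, mul_inv_cancel₀ h0, one_smul] at hξ
  exact hξ.symm

end IsFourierL2

end Fourier

/-! ### Hermitian structure of the Clifford algebra: adjoints of left multiplications. -/

namespace Cliff

variable {m : ℕ}

/-- Clifford multiplication as a continuous bilinear map. -/
def mulL (m : ℕ) : Cliff m →L[ℂ] Cliff m →L[ℂ] Cliff m :=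
  (LinearMap.mul ℂ (Cliff m)).toContinuousBilinearMap

@[simp] theorem mulL_apply (x y : Cliff m) : mulL m x y = x * y := rfl

instance : ContinuousMul (Cliff m) :=
  ⟨(mulL m).continuous₂⟩

theorem star_smul' (c : ℂ) (x : Cliff m) : star (c • x) = (starRingEnd ℂ) c • star x := by
  ext T; simp only [coeff_star, coeff_smul, map_mul]; ring

theorem norm_star (x : Cliff m) : ‖star x‖ = ‖x‖ := by
  rw [← sq_eq_sq₀ (norm_nonneg _) (norm_nonneg _), norm_sq, norm_sq]
  refine Finset.sum_congr rfl fun T _ => ?_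
  have h : ‖sign T T‖ * ‖sign T T‖ = 1 := by rw [← norm_mul, sign_mul_self]; simp
  rw [coeff_star, norm_mul, mul_pow, sq ‖sign T T‖, h, one_mul, RCLike.norm_conj]

/-- Clifford conjugation as a continuous real-linear map. -/
def starL (m : ℕ) : Cliff m →L[ℝ] Cliff m :=
  LinearMap.mkContinuous
    { toFun := star
      map_add' := star_add
      map_smul' := fun c x => by
        rw [← Complex.coe_smul, star_smul', Complex.conj_ofReal, Complex.coe_smul]; rfl } 1
    (fun x => by simp [norm_star])

@[simp] theorem starL_apply (x : Cliff m) : starL m x = star x := rfl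

theorem inner_eq_coeff (x y : Cliff m) : inner ℂ x y = (star x * y).coeff ∅ := by
  have h : inner ℂ x y = ∑ T, inner ℂ (x.coeff T) (y.coeff T) :=
    PiLp.inner_apply (𝕜 := ℂ) (ι := Finset (Fin m)) x y
  rw [h, coeff_mul]
  refine Finset.sum_congr rfl fun T _ => ?_
  have : T ∆ ∅ = T := symmDiff_bot T
  rw [this, coeff_star, ← mul_assoc, sign_mul_self, one_mul, RCLike.inner_apply, mul_comm]

/-- Left multiplication by `star x` is adjoint to left multiplication by `x`. -/
theorem inner_mul_right (x u v : Cliff m) : inner ℂ u (x * v) = inner ℂ (star x * u) v := by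
  rw [inner_eq_coeff, inner_eq_coeff, star_mul, star_star, mul_assoc]

theorem inner_e_mul (k : Fin m) (u v : Cliff m) :
    inner ℂ u (e k * v) = -inner ℂ (e k * u) v := by
  rw [inner_mul_right, star_e, neg_mul, inner_neg_left]

/-- Left multiplication by e_k is skew-adjoint with square -1, hence isometric. -/
theorem norm_e_mul (k : Fin m) (u : Cliff m) : ‖e k * u‖ = ‖u‖ := by
  have h1 : e k * e k = (-1 : ℂ) • (1 : Cliff m) := by
    have := e_mul_e_add k k
    rw [if_pos rfl, ← two_smul ℂ] at this
    have h2 : (2 : ℂ) • (e k * e k) = (2 : ℂ) • ((-1 : ℂ) • (1 : Cliff m)) := by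
      rw [this, smul_smul]; norm_num
    exact smul_right_injective (Cliff m) (two_ne_zero (α := ℂ)) h2
  rw [← sq_eq_sq₀ (norm_nonneg _) (norm_nonneg _)]
  have h2 : inner ℂ (e k * u) (e k * u) = inner ℂ u u := by
    rw [inner_e_mul, ← mul_assoc, h1]; simp
  rw [inner_self_eq_norm_sq_to_K, inner_self_eq_norm_sq_to_K] at h2
  exact_mod_cast h2

theorem star_vec (ξ : EuclideanSpace ℝ (Fin m)) : star (vec ξ) = -vec ξ := by
  simp only [vec, star_sum, star_smul', star_e, Complex.conj_ofReal, smul_neg,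
    Finset.sum_neg_distrib]

/-- Adding the double sum over (j,k) to the one with the factors interchanged leaves only
anticommutators, so the off-diagonal terms vanish. -/
theorem vec_mul_vec (ξ : EuclideanSpace ℝ (Fin m)) :
    vec ξ * vec ξ = (-(‖ξ‖ ^ 2 : ℝ) : ℂ) • (1 : Cliff m) := by
  have h1 : vec ξ * vec ξ = ∑ j, ∑ k, ((ξ j : ℂ) * ξ k) • (e j * e k) := by
    simp only [vec, Finset.sum_mul, Finset.mul_sum, smul_mul_smul_comm]
    exact Finset.sum_comm
  have h2 : vec ξ * vec ξ = ∑ j, ∑ k, ((ξ j : ℂ) * ξ k) • (e k * e j) := by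
    rw [h1, Finset.sum_comm]
    exact Finset.sum_congr rfl fun j _ => Finset.sum_congr rfl fun k _ => by rw [mul_comm]
  have h3 : (2 : ℂ) • (vec ξ * vec ξ) = (2 : ℂ) • ((-(‖ξ‖ ^ 2 : ℝ) : ℂ) • (1 : Cliff m)) := by
    rw [two_smul]
    nth_rewrite 1 [h1]
    rw [h2]
    simp only [← Finset.sum_add_distrib, ← smul_add, e_mul_e_add, smul_ite, smul_zero,
      Finset.sum_ite_eq, Finset.mem_univ, if_true, smul_smul, ← Finset.sum_smul]
    congr 1
    rw [EuclideanSpace.norm_sq_eq, ← Finset.sum_mul]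
    push_cast
    simp only [← Complex.ofReal_pow, Real.norm_eq_abs, sq_abs]
    simp only [Complex.ofReal_pow, ← pow_two]
    ring
  exact smul_right_injective (Cliff m) (two_ne_zero (α := ℂ)) h3

theorem continuous_vec : Continuous (vec : EuclideanSpace ℝ (Fin m) → Cliff m) := by
  unfold vec; fun_prop

end Cliff

/-! ### Algebra of the projections χ_± and of the monogenic exponential. -/

section MonogenicExponential

open Cliff

variable {m : ℕ}

/-- Conjugation changes the sign of both i and ξ. Left multiplication by χ_s is therefore
self-adjoint. -/
theorem star_chi (s : ℝ) (ξ : EuclideanSpace ℝ (Fin m)) : star (chi s ξ) = chi s ξ := by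
  simp only [chi, star_smul', star_add, star_one, star_vec, map_div₀, map_mul, Complex.conj_ofReal,
    Complex.conj_I, map_one, map_ofNat]
  congr 2
  rw [smul_neg, ← neg_smul]
  congr 1
  ring

theorem chi_one_add_chi_neg_one (ξ : EuclideanSpace ℝ (Fin m)) : chi 1 ξ + chi (-1) ξ = 1 := by
  simp only [chi, ← smul_add]
  push_cast
  rw [neg_mul, neg_div]
  module

theorem chi_mul_chi (s t : ℝ) {ξ : EuclideanSpace ℝ (Fin m)} (hξ : ξ ≠ 0) :
    chi s ξ * chi t ξ =
      (1 / 4 : ℂ) • ((1 + s * t : ℂ) • (1 : Cliff m) +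
        ((s + t : ℂ) * Complex.I / (‖ξ‖ : ℂ)) • vec ξ) := by
  have h0 : (‖ξ‖ : ℂ) ≠ 0 := by exact_mod_cast norm_ne_zero_iff.2 hξ
  simp only [chi, smul_mul_smul_comm, add_mul, mul_add, one_mul, mul_one, vec_mul_vec, smul_smul]
  have : (s : ℂ) * Complex.I / ‖ξ‖ * (t * Complex.I / ‖ξ‖) * -((‖ξ‖ ^ 2 : ℝ) : ℂ) = s * t := by
    push_cast
    field_simp
    rw [Complex.I_sq]; ring
  rw [this]
  module

/-- The condition ξ ≠ 0 is essential: since division by zero gives 0, χ_s(0) = 1/2, which is not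
idempotent. Later identities therefore hold only for almost every ξ. -/
theorem chi_mul_self {s : ℝ} (hs : s * s = 1) {ξ : EuclideanSpace ℝ (Fin m)} (hξ : ξ ≠ 0) :
    chi s ξ * chi s ξ = chi s ξ := by
  rw [chi_mul_chi s s hξ, chi]
  have h : (s : ℂ) * s = 1 := by exact_mod_cast hs
  rw [h]
  module

theorem chi_mul_chi_neg {s : ℝ} (hs : s * s = 1) {ξ : EuclideanSpace ℝ (Fin m)} (hξ : ξ ≠ 0) :
    chi s ξ * chi (-s) ξ = 0 := by
  have h : (s : ℂ) * s = 1 := by exact_mod_cast hs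
  rw [chi_mul_chi s (-s) hξ]
  push_cast
  rw [mul_neg, h]
  simp

/-- The eigenvalue relation behind monogenicity: applied to e^s(x,ξ), the vector part of the Dirac
operator gives s|ξ|, which cancels the x_0-derivative. -/
theorem I_smul_vec_mul_chi {s : ℝ} (hs : s * s = 1) (ξ : EuclideanSpace ℝ (Fin m)) :
    Complex.I • (vec ξ * chi s ξ) = (s * ‖ξ‖ : ℂ) • chi s ξ := by
  by_cases hξ : ξ = 0
  · subst hξ; simp [vec]
  have h0 : (‖ξ‖ : ℂ) ≠ 0 := by exact_mod_cast norm_ne_zero_iff.2 hξ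
  have h : (s : ℂ) * s = 1 := by exact_mod_cast hs
  simp only [chi, mul_smul_comm, mul_add, mul_one, vec_mul_vec, smul_smul, smul_add]
  rw [add_comm]
  congr 2
  · push_cast
    field_simp
    linear_combination (-(s : ℂ)) * Complex.I_sq
  · field_simp
    linear_combination (-1 : ℂ) * h

theorem inner_chi_mul_chi_mul {ξ : EuclideanSpace ℝ (Fin m)} (hξ : ξ ≠ 0) (u v : Cliff m) :
    inner ℂ (chi 1 ξ * u) (chi (-1) ξ * v) = 0 := by
  rw [inner_mul_right, star_chi, ← mul_assoc]
  have := chi_mul_chi_neg (s := -1) (by norm_num) hξ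
  rw [neg_neg] at this
  simp [this]

/-- Pythagoras: χ_+v and χ_-v are orthogonal with sum v. -/
theorem norm_sq_chi_mul_add {ξ : EuclideanSpace ℝ (Fin m)} (hξ : ξ ≠ 0) (v : Cliff m) :
    ‖chi 1 ξ * v‖ ^ 2 + ‖chi (-1) ξ * v‖ ^ 2 = ‖v‖ ^ 2 := by
  have h := norm_add_sq_eq_norm_sq_add_norm_sq_of_inner_eq_zero _ _
    (inner_chi_mul_chi_mul hξ v v)
  rw [← add_mul, chi_one_add_chi_neg_one, one_mul] at h
  simp only [sq, h]

theorem norm_chi_mul_le {s : ℝ} (hs : s * s = 1) (ξ : EuclideanSpace ℝ (Fin m)) (v : Cliff m) :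
    ‖chi s ξ * v‖ ≤ ‖v‖ := by
  by_cases hξ : ξ = 0
  · subst hξ
    simp only [chi, vec, PiLp.zero_apply, Complex.ofReal_zero, zero_smul, Finset.sum_const_zero,
      smul_zero, add_zero, smul_mul_assoc, one_mul, norm_smul]
    norm_num
    linarith [norm_nonneg v]
  have h := norm_sq_chi_mul_add hξ v
  have hs' : s = 1 ∨ s = -1 := mul_self_eq_one_iff.1 hs
  refine le_of_sq_le_sq ?_ (norm_nonneg _)
  rcases hs' with rfl | rfl
  · linarith [sq_nonneg ‖chi (-1) ξ * v‖]
  · linarith [sq_nonneg ‖chi 1 ξ * v‖]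

theorem monoExpSign_eq (s : ℝ) (x : ParaVec m) (ξ : EuclideanSpace ℝ (Fin m)) :
    monoExpSign s x ξ =
      Complex.exp (Complex.I * (inner ℝ x.2 ξ : ℝ) - (s * x.1 * ‖ξ‖ : ℝ)) • chi s ξ := by
  rw [monoExpSign, ← Complex.exp_add, sub_eq_add_neg]

theorem norm_cexp_I_mul_sub (p q : ℝ) :
    ‖Complex.exp (Complex.I * p - q)‖ = Real.exp (-q) := by
  rw [Complex.norm_exp]; simp

theorem norm_monoExpSign_mul_le {s : ℝ} (hs : s * s = 1) (x : ParaVec m)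
    (ξ : EuclideanSpace ℝ (Fin m)) (v : Cliff m) :
    ‖monoExpSign s x ξ * v‖ ≤ Real.exp (|x.1| * ‖ξ‖) * ‖v‖ := by
  rw [monoExpSign_eq, smul_mul_assoc, norm_smul, norm_cexp_I_mul_sub]
  have hs' : |s| = 1 := by rcases mul_self_eq_one_iff.1 hs with rfl | rfl <;> simp
  have : -(s * x.1 * ‖ξ‖) ≤ |x.1| * ‖ξ‖ := by
    have := neg_abs_le (s * x.1)
    rw [abs_mul, hs', one_mul] at this
    nlinarith [norm_nonneg ξ]
  gcongr
  exact norm_chi_mul_le hs ξ v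

theorem norm_monoExp_mul_le (x : ParaVec m) (ξ : EuclideanSpace ℝ (Fin m)) (v : Cliff m) :
    ‖monoExp x ξ * v‖ ≤ 2 * Real.exp (|x.1| * ‖ξ‖) * ‖v‖ := by
  rw [monoExp, add_mul]
  refine (norm_add_le _ _).trans ?_
  have h1 := norm_monoExpSign_mul_le (s := 1) (by norm_num) x ξ v
  have h2 := norm_monoExpSign_mul_le (s := -1) (by norm_num) x ξ v
  linarith

theorem star_monoExpSign (s : ℝ) (x : ParaVec m) (ξ : EuclideanSpace ℝ (Fin m)) :
    star (monoExpSign s x ξ) = monoExpSign s x.conj ξ := by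
  rw [monoExpSign_eq, monoExpSign_eq, star_smul', star_chi, ← Complex.exp_conj]
  simp [ParaVec.conj, inner_neg_left]

/-- With `inner_mul_right` this gives the adjoint of left multiplication by e(x,ξ); it is the source
of the argument w + x̄ in the kernel. -/
theorem star_monoExp (x : ParaVec m) (ξ : EuclideanSpace ℝ (Fin m)) :
    star (monoExp x ξ) = monoExp x.conj ξ := by
  rw [monoExp, star_add, star_monoExpSign, star_monoExpSign, monoExp]

theorem monoExpSign_mul_self {s : ℝ} (hs : s * s = 1) (x y : ParaVec m)
    {ξ : EuclideanSpace ℝ (Fin m)} (hξ : ξ ≠ 0) :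
    monoExpSign s x ξ * monoExpSign s y ξ = monoExpSign s (x + y) ξ := by
  simp only [monoExpSign_eq, smul_mul_smul_comm, chi_mul_self hs hξ, ← Complex.exp_add]
  congr 2
  simp only [Prod.fst_add, Prod.snd_add, inner_add_left]
  push_cast; ring

/-- The cross terms contain χ_+χ_- = 0, and on each χ_s the exponential is a scalar character. -/
theorem monoExp_mul (x y : ParaVec m) {ξ : EuclideanSpace ℝ (Fin m)} (hξ : ξ ≠ 0) :
    monoExp x ξ * monoExp y ξ = monoExp (x + y) ξ := by
  have h1 : monoExpSign 1 x ξ * monoExpSign (-1) y ξ = 0 := by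
    simp only [monoExpSign_eq, smul_mul_smul_comm, chi_mul_chi_neg (s := 1) (by norm_num) hξ,
      smul_zero]
  have h2 : monoExpSign (-1) x ξ * monoExpSign 1 y ξ = 0 := by
    have := chi_mul_chi_neg (s := -1) (by norm_num) hξ
    rw [neg_neg] at this
    simp only [monoExpSign_eq, smul_mul_smul_comm, this, smul_zero]
  rw [monoExp, monoExp, add_mul, mul_add, mul_add, h1, h2, monoExpSign_mul_self (by norm_num) x y hξ,
    monoExpSign_mul_self (by norm_num) x y hξ, monoExp, add_zero, zero_add]

theorem monoExp_zero (ξ : EuclideanSpace ℝ (Fin m)) : monoExp 0 ξ = 1 := by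
  simp [monoExp, monoExpSign_eq, chi_one_add_chi_neg_one]

theorem monoExp_mk (t : ℝ) (y ξ : EuclideanSpace ℝ (Fin m)) :
    monoExp (t, y) ξ = Complex.exp (Complex.I * (inner ℝ y ξ : ℝ)) • monoExp (t, 0) ξ := by
  simp [monoExp, monoExpSign, smul_smul]

theorem stronglyMeasurable_chi (s : ℝ) :
    StronglyMeasurable (chi s : EuclideanSpace ℝ (Fin m) → Cliff m) := by
  unfold chi
  have h : StronglyMeasurable fun ξ : EuclideanSpace ℝ (Fin m) =>
      ((s : ℂ) * Complex.I / (‖ξ‖ : ℂ)) := by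
    refine Measurable.stronglyMeasurable ?_
    fun_prop
  have h2 := continuous_vec (m := m).stronglyMeasurable
  exact (stronglyMeasurable_const.add (h.smul h2)).const_smul (1 / 2 : ℂ)

theorem stronglyMeasurable_monoExpSign (s : ℝ) :
    StronglyMeasurable fun p : ParaVec m × EuclideanSpace ℝ (Fin m) => monoExpSign s p.1 p.2 := by
  simp only [monoExpSign_eq]
  have h : Continuous fun p : ParaVec m × EuclideanSpace ℝ (Fin m) =>
      Complex.exp (Complex.I * (inner ℝ p.1.2 p.2 : ℝ) - (s * p.1.1 * ‖p.2‖ : ℝ)) := by fun_prop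
  exact h.stronglyMeasurable.smul ((stronglyMeasurable_chi s).comp_measurable measurable_snd)

theorem stronglyMeasurable_monoExp :
    StronglyMeasurable fun p : ParaVec m × EuclideanSpace ℝ (Fin m) => monoExp p.1 p.2 :=
  (stronglyMeasurable_monoExpSign 1).add (stronglyMeasurable_monoExpSign (-1))

theorem stronglyMeasurable_monoExpSign_right (s : ℝ) (x : ParaVec m) :
    StronglyMeasurable fun ξ : EuclideanSpace ℝ (Fin m) => monoExpSign s x ξ := by
  simp only [monoExpSign_eq]
  have h : Continuous fun ξ : EuclideanSpace ℝ (Fin m) =>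
    Complex.exp (Complex.I * (inner ℝ x.2 ξ : ℝ) - (s * x.1 * ‖ξ‖ : ℝ)) := by fun_prop
  exact h.stronglyMeasurable.smul (stronglyMeasurable_chi s)

theorem stronglyMeasurable_monoExp_right (x : ParaVec m) :
    StronglyMeasurable fun ξ : EuclideanSpace ℝ (Fin m) => monoExp x ξ :=
  (stronglyMeasurable_monoExpSign_right 1 x).add (stronglyMeasurable_monoExpSign_right (-1) x)

theorem continuous_monoExp_left (ξ : EuclideanSpace ℝ (Fin m)) :
    Continuous fun x : ParaVec m => monoExp x ξ := by
  have h : ∀ s : ℝ, Continuous fun x : ParaVec m => monoExpSign s x ξ := fun s => by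
    simp only [monoExpSign_eq]
    have : Continuous fun x : ParaVec m =>
      Complex.exp (Complex.I * (inner ℝ x.2 ξ : ℝ) - (s * x.1 * ‖ξ‖ : ℝ)) := by fun_prop
    exact this.smul continuous_const
  exact (h 1).add (h (-1))

end MonogenicExponential

/-! ### The weight: bounds from below and its origin as an integral over |t| < a. -/

section Weight

open Cliff

variable {m : ℕ}

theorem bergmanWeight_inv (a : ℝ) (ξ : EuclideanSpace ℝ (Fin m)) :
    2 * ‖ξ‖ / (Real.exp (2 * a * ‖ξ‖) - Real.exp (-(2 * a * ‖ξ‖))) = (bergmanWeight a ξ)⁻¹ := by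
  rw [bergmanWeight, inv_div]

theorem measurable_bergmanWeight (a : ℝ) :
    Measurable (bergmanWeight a : EuclideanSpace ℝ (Fin m) → ℝ) := by
  unfold bergmanWeight; fun_prop

/-- The numerator is at least e^{2c|ξ|}(e^{2(a-c)|ξ|} - 1), and e^u - 1 ≥ u produces the factor 2|ξ|
that cancels the denominator. -/
theorem le_bergmanWeight {a c : ℝ} (hc : 0 ≤ c) (hca : c ≤ a) {ξ : EuclideanSpace ℝ (Fin m)}
    (hξ : ξ ≠ 0) : (a - c) * Real.exp (2 * c * ‖ξ‖) ≤ bergmanWeight a ξ := by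
  have hr : 0 < ‖ξ‖ := norm_pos_iff.2 hξ
  rw [bergmanWeight, le_div_iff₀ (by positivity)]
  have h1 : Real.exp (-(2 * a * ‖ξ‖)) ≤ Real.exp (2 * c * ‖ξ‖) :=
    Real.exp_le_exp.2 (by nlinarith [mul_nonneg hc hr.le, mul_nonneg (hc.trans hca) hr.le])
  have h2 : Real.exp (2 * a * ‖ξ‖) = Real.exp (2 * c * ‖ξ‖) * Real.exp (2 * (a - c) * ‖ξ‖) := by
    rw [← Real.exp_add]; congr 1; ring
  have h3 := Real.add_one_le_exp (2 * (a - c) * ‖ξ‖)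
  have h4 := Real.exp_pos (2 * c * ‖ξ‖)
  rw [h2]
  nlinarith

theorem bergmanWeight_nonneg {a : ℝ} (ha : 0 < a) (ξ : EuclideanSpace ℝ (Fin m)) :
    0 ≤ bergmanWeight a ξ := by
  by_cases hξ : ξ = 0
  · simp [hξ, bergmanWeight]
  · exact le_trans (by positivity) (le_bergmanWeight le_rfl ha.le hξ)

theorem bergmanWeight_pos {a : ℝ} (ha : 0 < a) {ξ : EuclideanSpace ℝ (Fin m)} (hξ : ξ ≠ 0) :
    0 < bergmanWeight a ξ :=
  lt_of_lt_of_le (by positivity) (le_bergmanWeight le_rfl ha.le hξ)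

/-- The weight dominates `e^{2b|ξ|}` for `b < a`, with an exponential gain. -/
theorem exists_exp_le_bergmanWeight {a b : ℝ} (ha : 0 < a) (hb : b < a) :
    ∃ C > 0, ∃ δ > 0, ∀ ξ : EuclideanSpace ℝ (Fin m), ξ ≠ 0 →
      Real.exp (2 * b * ‖ξ‖) ≤ C * (bergmanWeight a ξ * Real.exp (-(δ * ‖ξ‖))) := by
  -- The rate c lies strictly between max(b,0) and a: `le_bergmanWeight` requires c ≥ 0, and the gap
  -- c - b supplies the decay δ = 2(c - b).
  obtain ⟨c, hc, hca⟩ := exists_between (max_lt hb ha)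
  obtain ⟨hbc, hc0⟩ := max_lt_iff.1 hc
  refine ⟨(a - c)⁻¹, inv_pos.2 (by linarith), 2 * (c - b), by linarith, fun ξ hξ => ?_⟩
  have h := le_bergmanWeight hc0.le hca.le hξ
  have h1 : Real.exp (2 * b * ‖ξ‖) =
      (a - c)⁻¹ * ((a - c) * Real.exp (2 * c * ‖ξ‖) * Real.exp (-(2 * (c - b) * ‖ξ‖))) := by
    rw [mul_assoc (a - c), ← Real.exp_add, inv_mul_cancel_left₀ (by linarith)]
    congr 1; ring
  rw [h1]
  have : 0 < a - c := by linarith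
  gcongr

/-- Comparison with the integrable (1+|ξ|)^{-(m+1)}, through u^n/n! ≤ e^u at u = δ(1+|ξ|); the shift
by 1 costs the constant e^δ. -/
theorem integrable_exp_neg_mul_norm {δ : ℝ} (hδ : 0 < δ) :
    Integrable (fun ξ : EuclideanSpace ℝ (Fin m) => Real.exp (-(δ * ‖ξ‖))) volume := by
  have h := integrable_one_add_norm (E := EuclideanSpace ℝ (Fin m)) (μ := volume)
    (r := ((m + 1 : ℕ) : ℝ)) (by simp)
  refine (h.const_mul (Real.exp δ * ((m + 1).factorial / δ ^ (m + 1)))).mono'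
    (by fun_prop) (.of_forall fun ξ => ?_)
  have h1 : 0 < 1 + ‖ξ‖ := by positivity
  have h2 := Real.pow_div_factorial_le_exp (δ * (1 + ‖ξ‖)) (by positivity) (m + 1)
  rw [Real.norm_of_nonneg (by positivity), Real.rpow_neg h1.le, Real.rpow_natCast, Real.exp_neg]
  rw [mul_add, mul_one, Real.exp_add, ← mul_one_add, mul_pow] at h2
  rw [inv_le_iff_one_le_mul₀ (by positivity)]
  calc (1 : ℝ) = (δ ^ (m + 1) * (1 + ‖ξ‖) ^ (m + 1) / (m + 1).factorial) *
        ((m + 1).factorial / δ ^ (m + 1) * ((1 + ‖ξ‖) ^ (m + 1))⁻¹) := by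
        have : ((m + 1).factorial : ℝ) ≠ 0 := by positivity
        field_simp
    _ ≤ (Real.exp δ * Real.exp (δ * ‖ξ‖)) *
        ((m + 1).factorial / δ ^ (m + 1) * ((1 + ‖ξ‖) ^ (m + 1))⁻¹) := by gcongr
    _ = _ := by ring

theorem setIntegral_exp_two_mul {a r : ℝ} (ha : 0 < a) (hr : r ≠ 0) :
    ∫ t in Set.Ioo (-a) a, Real.exp (2 * t * r) =
      (Real.exp (2 * a * r) - Real.exp (-(2 * a * r))) / (2 * r) := by
  rw [← integral_Ioc_eq_integral_Ioo, ← intervalIntegral.integral_of_le (by linarith)]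
  have h := intervalIntegral.integral_comp_mul_left (a := -a) (b := a) (f := Real.exp)
    (c := 2 * r) (by simpa using hr)
  rw [integral_exp] at h
  have h' : ∀ t : ℝ, 2 * t * r = 2 * r * t := fun t => by ring
  simp only [h', h, smul_eq_mul]
  rw [div_eq_inv_mul]
  congr 3
  ring

theorem setIntegral_exp_two_mul_neg {a r : ℝ} (ha : 0 < a) (hr : r ≠ 0) :
    ∫ t in Set.Ioo (-a) a, Real.exp (-(2 * t * r)) =
      (Real.exp (2 * a * r) - Real.exp (-(2 * a * r))) / (2 * r) := by
  have h := setIntegral_exp_two_mul ha (neg_ne_zero.2 hr)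
  simp only [mul_neg, neg_neg] at h
  rw [h, ← neg_div_neg_eq]
  congr 1
  · ring
  · ring

theorem inner_monoExp_mul {x : ParaVec m} {ξ : EuclideanSpace ℝ (Fin m)} (u v : Cliff m) :
    inner ℂ (monoExp x ξ * u) v = inner ℂ u (monoExp x.conj ξ * v) := by
  rw [inner_mul_right, star_monoExp]
  simp [ParaVec.conj]

/-- The adjoint of e(t,ξ) is itself, so the group law leaves e(2t,ξ) acting on v. -/
theorem inner_monoExp_mul_monoExp_mul (t : ℝ) {ξ : EuclideanSpace ℝ (Fin m)} (hξ : ξ ≠ 0)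
    (u v : Cliff m) :
    inner ℂ (monoExp (t, 0) ξ * u) (monoExp (t, 0) ξ * v) =
      (Real.exp (-(2 * t * ‖ξ‖)) : ℂ) * inner ℂ u (chi 1 ξ * v) +
        (Real.exp (2 * t * ‖ξ‖) : ℂ) * inner ℂ u (chi (-1) ξ * v) := by
  rw [inner_monoExp_mul, ← mul_assoc, monoExp_mul _ _ hξ]
  simp only [monoExp, monoExpSign_eq, ParaVec.conj, Prod.mk_add_mk, neg_zero, add_zero,
    inner_zero_left, add_mul, smul_mul_assoc, inner_add_right, inner_smul_right]
  push_cast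
  congr 3 <;> ring_nf

/-- As the interval is symmetric, both exponentials have the same integral, namely the weight; then
χ_+ + χ_- = 1. -/
theorem setIntegral_inner_monoExp_mul {a : ℝ} (ha : 0 < a) {ξ : EuclideanSpace ℝ (Fin m)}
    (hξ : ξ ≠ 0) (u v : Cliff m) :
    ∫ t in Set.Ioo (-a) a, inner ℂ (monoExp (t, 0) ξ * u) (monoExp (t, 0) ξ * v) =
      (bergmanWeight a ξ : ℂ) * inner ℂ u v := by
  have hr : ‖ξ‖ ≠ 0 := norm_ne_zero_iff.2 hξ
  have hi : ∀ s : ℝ, Integrable (fun t : ℝ => ((Real.exp (s * (2 * t * ‖ξ‖)) : ℝ) : ℂ))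
      (volume.restrict (Set.Ioo (-a) a)) := fun s =>
    (Continuous.integrableOn_Icc (by fun_prop)).mono_set Set.Ioo_subset_Icc_self
  have h1 := hi (-1)
  have h2 := hi 1
  simp only [neg_one_mul, one_mul] at h1 h2
  simp only [inner_monoExp_mul_monoExp_mul _ hξ]
  rw [integral_add (h1.mul_const _) (h2.mul_const _), integral_mul_const, integral_mul_const,
    integral_complex_ofReal, integral_complex_ofReal, setIntegral_exp_two_mul ha hr,
    setIntegral_exp_two_mul_neg ha hr, ← mul_add, ← inner_add_right, ← add_mul,
    chi_one_add_chi_neg_one, one_mul, bergmanWeight]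

theorem lintegral_norm_sq_monoExp_mul {a : ℝ} (ha : 0 < a) {ξ : EuclideanSpace ℝ (Fin m)}
    (hξ : ξ ≠ 0) (v : Cliff m) :
    ∫⁻ t in Set.Ioo (-a) a, ENNReal.ofReal (‖monoExp (t, 0) ξ * v‖ ^ 2) =
      ENNReal.ofReal (bergmanWeight a ξ * ‖v‖ ^ 2) := by
  have hcont : Continuous fun t : ℝ => ‖monoExp (t, 0) ξ * v‖ ^ 2 := by
    have := (continuous_monoExp_left ξ).comp (Continuous.prodMk_left (0 : EuclideanSpace ℝ (Fin m)))
    exact ((this.mul continuous_const).norm).pow 2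
  rw [← ofReal_integral_eq_lintegral_ofReal
    (hcont.integrableOn_Icc.mono_set Set.Ioo_subset_Icc_self) (.of_forall fun t => by positivity)]
  congr 1
  have h := setIntegral_inner_monoExp_mul ha hξ v v
  simp only [inner_self_eq_norm_sq_to_K] at h
  have h2 : ∀ x : Cliff m, ((‖x‖ : ℂ)) ^ 2 = ((‖x‖ ^ 2 : ℝ) : ℂ) := fun x => by push_cast; rfl
  change ∫ t in Set.Ioo (-a) a, ((‖monoExp (t, 0) ξ * v‖ : ℂ)) ^ 2 = _ * ((‖v‖ : ℂ)) ^ 2 at h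
  simp only [h2] at h
  rw [integral_complex_ofReal] at h
  exact_mod_cast h

end Weight

/-! ### Synthesis of left-monogenic functions from weighted spectra. -/

section Synthesis

open Cliff Filter Topology

variable {m : ℕ}

theorem isOpen_strip (m : ℕ) (a : ℝ) : IsOpen (strip m a) :=
  isOpen_lt (by fun_prop) continuous_const

/-- This is where m ≥ 1 enters: for m = 0 the frequency space is the single point 0. -/
theorem ae_ne_zero [NeZero m] : ∀ᵐ ξ : EuclideanSpace ℝ (Fin m), ξ ≠ 0 := by
  have : Nonempty (Fin m) := ⟨0⟩
  have : Nontrivial (EuclideanSpace ℝ (Fin m)) := inferInstance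
  exact Measure.ae_ne volume 0

/-- Measurable functions on the frequency space with `∫ w |g|² < ∞`. -/
def MemWeighted (a : ℝ) (g : EuclideanSpace ℝ (Fin m) → Cliff m) : Prop :=
  AEStronglyMeasurable g volume ∧ Integrable (fun ξ => bergmanWeight a ξ * ‖g ξ‖ ^ 2) volume

namespace MemWeighted

variable {a b : ℝ} {g : EuclideanSpace ℝ (Fin m) → Cliff m}

theorem integrable_exp_mul_norm_sq [NeZero m] (hg : MemWeighted a g) (ha : 0 < a) (hb : b < a) :
    Integrable (fun ξ => Real.exp (2 * b * ‖ξ‖) * ‖g ξ‖ ^ 2) volume := by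
  obtain ⟨C, hC, δ, hδ, h⟩ := exists_exp_le_bergmanWeight (m := m) ha hb
  refine (hg.2.const_mul C).mono' ?_ ?_
  · exact (Continuous.aestronglyMeasurable (by fun_prop)).mul (hg.1.norm.pow 2)
  filter_upwards [ae_ne_zero] with ξ hξ
  rw [Real.norm_of_nonneg (by positivity), ← mul_assoc]
  gcongr
  refine (h ξ hξ).trans ?_
  have := bergmanWeight_nonneg ha ξ
  have h1 : Real.exp (-(δ * ‖ξ‖)) ≤ 1 := Real.exp_le_one_iff.2 (by simp; positivity)
  gcongr
  exact mul_le_of_le_one_right this h1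

/-- The square of the integrand is at most PQ ≤ (P+Q)², with P a decaying exponential and Q the
weighted density of g, both integrable. -/
theorem integrable_exp_mul_norm [NeZero m] (hg : MemWeighted a g) (ha : 0 < a) (hb : b < a) :
    Integrable (fun ξ => Real.exp (b * ‖ξ‖) * ‖g ξ‖) volume := by
  obtain ⟨C, hC, δ, hδ, h⟩ := exists_exp_le_bergmanWeight (m := m) ha hb
  refine ((integrable_exp_neg_mul_norm (m := m) hδ).const_mul C |>.add hg.2).mono' ?_ ?_
  · exact (Continuous.aestronglyMeasurable (by fun_prop)).mul hg.1.norm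
  filter_upwards [ae_ne_zero] with ξ hξ
  rw [Real.norm_of_nonneg (by positivity)]
  have hw := bergmanWeight_nonneg ha ξ
  set P := C * Real.exp (-(δ * ‖ξ‖))
  set Q := bergmanWeight a ξ * ‖g ξ‖ ^ 2
  have hP : 0 ≤ P := by positivity
  have hQ : 0 ≤ Q := by positivity
  have h1 : (Real.exp (b * ‖ξ‖) * ‖g ξ‖) ^ 2 ≤ P * Q := by
    rw [mul_pow, ← Real.exp_nat_mul]
    have h2 : ((2 : ℕ) : ℝ) * (b * ‖ξ‖) = 2 * b * ‖ξ‖ := by push_cast; ring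
    rw [h2]
    calc _ ≤ C * (bergmanWeight a ξ * Real.exp (-(δ * ‖ξ‖))) * ‖g ξ‖ ^ 2 := by
          gcongr; exact h ξ hξ
      _ = _ := by ring
  refine le_of_sq_le_sq ?_ (add_nonneg hP hQ)
  change _ ≤ (P + Q) ^ 2
  nlinarith

/-- Majorant for first derivatives: the factor |ξ| is absorbed by raising the rate from b to some c
< a. -/
theorem integrable_norm_mul_exp_mul_norm [NeZero m] (hg : MemWeighted a g) (ha : 0 < a)
    (hb : b < a) : Integrable (fun ξ => ‖ξ‖ * (Real.exp (b * ‖ξ‖) * ‖g ξ‖)) volume := by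
  obtain ⟨c, hbc, hca⟩ := exists_between hb
  refine ((hg.integrable_exp_mul_norm ha hca).const_mul (c - b)⁻¹).mono' ?_ ?_
  · exact continuous_norm.aestronglyMeasurable.mul
      ((Continuous.aestronglyMeasurable (by fun_prop)).mul hg.1.norm)
  refine .of_forall fun ξ => ?_
  rw [Real.norm_of_nonneg (by positivity), ← mul_assoc, ← mul_assoc]
  have hcb : 0 < c - b := by linarith
  refine mul_le_mul_of_nonneg_right ?_ (norm_nonneg _)
  rw [inv_mul_eq_div, le_div_iff₀ hcb]
  have h1 := Real.add_one_le_exp ((c - b) * ‖ξ‖)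
  have h2 : Real.exp (c * ‖ξ‖) = Real.exp ((c - b) * ‖ξ‖) * Real.exp (b * ‖ξ‖) := by
    rw [← Real.exp_add]; congr 1; ring
  rw [h2]
  nlinarith [Real.exp_pos (b * ‖ξ‖)]

theorem aestronglyMeasurable_monoExpSign_mul (hg : MemWeighted a g) (s : ℝ) (x : ParaVec m) :
    AEStronglyMeasurable (fun ξ => monoExpSign s x ξ * g ξ) volume := by
  exact (stronglyMeasurable_monoExpSign_right s x).aestronglyMeasurable.mul hg.1

theorem aestronglyMeasurable_monoExp_mul (hg : MemWeighted a g) (x : ParaVec m) :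
    AEStronglyMeasurable (fun ξ => monoExp x ξ * g ξ) volume := by
  exact (stronglyMeasurable_monoExp_right x).aestronglyMeasurable.mul hg.1

theorem integrable_monoExpSign_mul [NeZero m] (hg : MemWeighted a g) (ha : 0 < a) {s : ℝ}
    (hs : s * s = 1) {x : ParaVec m} (hx : x ∈ strip m a) :
    Integrable (fun ξ => monoExpSign s x ξ * g ξ) volume :=
  (hg.integrable_exp_mul_norm ha hx).mono' (hg.aestronglyMeasurable_monoExpSign_mul s x)
    (.of_forall fun ξ => norm_monoExpSign_mul_le hs x ξ _)

theorem integrable_monoExp_mul [NeZero m] (hg : MemWeighted a g) (ha : 0 < a)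
    {x : ParaVec m} (hx : x ∈ strip m a) :
    Integrable (fun ξ => monoExp x ξ * g ξ) volume := by
  simp only [monoExp, add_mul]
  exact (hg.integrable_monoExpSign_mul ha (by norm_num) hx).add
    (hg.integrable_monoExpSign_mul ha (by norm_num) hx)

theorem memLp_monoExp_mul [NeZero m] (hg : MemWeighted a g) (ha : 0 < a)
    {x : ParaVec m} (hx : x ∈ strip m a) :
    MemLp (fun ξ => monoExp x ξ * g ξ) 2 volume := by
  have hm := hg.aestronglyMeasurable_monoExp_mul x
  rw [memLp_two_iff_integrable_sq_norm hm]
  refine ((hg.integrable_exp_mul_norm_sq ha hx).const_mul 4).mono' (hm.norm.pow 2)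
    (.of_forall fun ξ => ?_)
  rw [Real.norm_of_nonneg (by positivity)]
  calc ‖monoExp x ξ * g ξ‖ ^ 2 ≤ (2 * Real.exp (|x.1| * ‖ξ‖) * ‖g ξ‖) ^ 2 := by
        gcongr; exact norm_monoExp_mul_le x ξ _
    _ = 4 * (Real.exp (2 * |x.1| * ‖ξ‖) * ‖g ξ‖ ^ 2) := by
        have : Real.exp (2 * |x.1| * ‖ξ‖) = Real.exp (|x.1| * ‖ξ‖) ^ 2 := by
          rw [← Real.exp_nat_mul]; congr 1; push_cast; ring
        rw [this]; ring

theorem memLp [NeZero m] (hg : MemWeighted a g) (ha : 0 < a) : MemLp g 2 volume := by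
  have h := hg.memLp_monoExp_mul ha (x := 0) (by simpa [strip] using ha)
  simpa [monoExp_zero] using h

end MemWeighted

/-- The function `x ↦ (2π)^{-m} ∫ e(x,ξ) g(ξ) dξ`. -/
def synth (g : EuclideanSpace ℝ (Fin m) → Cliff m) (x : ParaVec m) : Cliff m :=
  (((2 * Real.pi) ^ m)⁻¹ : ℝ) • ∫ ξ, monoExp x ξ * g ξ

theorem synth_mk (g : EuclideanSpace ℝ (Fin m) → Cliff m) (t : ℝ) (y : EuclideanSpace ℝ (Fin m)) :
    synth g (t, y) = fourierSynth (fun ξ => monoExp (t, 0) ξ * g ξ) y := by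
  simp only [synth, fourierSynth, monoExp_mk t y, smul_mul_assoc]

theorem MemWeighted.isFourierL2_synth [NeZero m] {a : ℝ}
    {g : EuclideanSpace ℝ (Fin m) → Cliff m} (hg : MemWeighted a g) (ha : 0 < a) {t : ℝ}
    (ht : |t| < a) : IsFourierL2 (fun y => synth g (t, y)) (fun ξ => monoExp (t, 0) ξ * g ξ) := by
  simp only [synth_mk]
  exact IsFourierL2.fourierSynth (hg.integrable_monoExp_mul ha ht) (hg.memLp_monoExp_mul ha ht)

/-! ### Derivative of the monogenic exponential and the Dirac equation. -/

section Derivative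

/-- The derivative in `x` of `e^s(x, ξ) v`, given the value `u = e^s(x, ξ) v`. -/
def monoExpDeriv (s : ℝ) (ξ : EuclideanSpace ℝ (Fin m)) (u : Cliff m) : ParaVec m →L[ℝ] Cliff m :=
  ContinuousLinearMap.smulRightL ℝ (ParaVec m) (Cliff m)
      ((innerSL ℝ ξ).comp (ContinuousLinearMap.snd ℝ ℝ (EuclideanSpace ℝ (Fin m)))) (Complex.I • u) -
    ContinuousLinearMap.smulRightL ℝ (ParaVec m) (Cliff m)
      (ContinuousLinearMap.fst ℝ ℝ (EuclideanSpace ℝ (Fin m))) ((s * ‖ξ‖) • u)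

theorem monoExpDeriv_apply (s : ℝ) (ξ : EuclideanSpace ℝ (Fin m)) (u : Cliff m) (h : ParaVec m) :
    monoExpDeriv s ξ u h = (inner ℝ ξ h.2 : ℝ) • (Complex.I • u) - h.1 • ((s * ‖ξ‖) • u) := rfl

/-- Joint continuity serves twice: for measurability in ξ of the differentiated integrand and for
its continuity in x. -/
theorem continuous_monoExpDeriv (s : ℝ) :
    Continuous fun p : EuclideanSpace ℝ (Fin m) × Cliff m => monoExpDeriv s p.1 p.2 := by
  unfold monoExpDeriv
  have h1 : Continuous fun p : EuclideanSpace ℝ (Fin m) × Cliff m =>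
      (innerSL ℝ p.1).comp (ContinuousLinearMap.snd ℝ ℝ (EuclideanSpace ℝ (Fin m))) := by
    fun_prop
  have h2 : Continuous fun p : EuclideanSpace ℝ (Fin m) × Cliff m => Complex.I • p.2 :=
    by fun_prop
  have h3 : Continuous fun p : EuclideanSpace ℝ (Fin m) × Cliff m => (s * ‖p.1‖) • p.2 := by
    fun_prop
  exact (((ContinuousLinearMap.smulRightL ℝ (ParaVec m) (Cliff m)).continuous₂).comp
    (h1.prodMk h2)).sub ((ContinuousLinearMap.smulRightL ℝ (ParaVec m) (Cliff m) _).continuous.comp h3)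

theorem norm_monoExpDeriv_le {s : ℝ} (hs : s * s = 1) (ξ : EuclideanSpace ℝ (Fin m))
    (u : Cliff m) : ‖monoExpDeriv s ξ u‖ ≤ 2 * (‖ξ‖ * ‖u‖) := by
  have hs' : |s| = 1 := by rcases mul_self_eq_one_iff.1 hs with rfl | rfl <;> simp
  refine ContinuousLinearMap.opNorm_le_bound _ (by positivity) fun h => ?_
  rw [monoExpDeriv_apply]
  have h1 : ‖(inner ℝ ξ h.2 : ℝ) • (Complex.I • u)‖ ≤ ‖ξ‖ * ‖h‖ * ‖u‖ := by
    rw [norm_smul, norm_smul, Complex.norm_I, one_mul]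
    gcongr
    exact (norm_inner_le_norm _ _).trans (by gcongr; exact norm_snd_le h)
  have h2 : ‖h.1 • ((s * ‖ξ‖) • u)‖ ≤ ‖h‖ * (‖ξ‖ * ‖u‖) := by
    rw [norm_smul, norm_smul, norm_mul, norm_norm, Real.norm_eq_abs s, hs', one_mul]
    gcongr
    exact norm_fst_le h
  refine (norm_sub_le _ _).trans ?_
  linarith

theorem hasFDerivAt_monoExpSign_mul (s : ℝ) (ξ : EuclideanSpace ℝ (Fin m)) (v : Cliff m)
    (x : ParaVec m) : HasFDerivAt (fun x => monoExpSign s x ξ * v)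
      (monoExpDeriv s ξ (monoExpSign s x ξ * v)) x := by
  have h1 : HasFDerivAt (fun x : ParaVec m => (inner ℝ ξ x.2 : ℝ))
      ((innerSL ℝ ξ).comp (ContinuousLinearMap.snd ℝ ℝ (EuclideanSpace ℝ (Fin m)))) x :=
    ((innerSL ℝ ξ).comp (ContinuousLinearMap.snd ℝ ℝ (EuclideanSpace ℝ (Fin m)))).hasFDerivAt
  have h2 : HasFDerivAt (fun x : ParaVec m => x.1)
      (ContinuousLinearMap.fst ℝ ℝ (EuclideanSpace ℝ (Fin m))) x := hasFDerivAt_fst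
  have h3 := (((Complex.ofRealCLM.hasFDerivAt.comp x h1).const_mul Complex.I).sub
    (Complex.ofRealCLM.hasFDerivAt.comp x (h2.const_mul (s * ‖ξ‖)))).cexp.smul_const (chi s ξ * v)
  refine (h3.congr_fderiv ?_).congr_of_eventuallyEq (.of_forall fun x => ?_)
  · refine ContinuousLinearMap.ext fun h => ?_
    rw [monoExpDeriv_apply, monoExpSign_eq]
    simp only [ContinuousLinearMap.smulRight_apply, smul_apply,
      sub_apply, ContinuousLinearMap.comp_apply, smul_mul_assoc]
    simp only [← Complex.coe_smul, smul_smul, ← sub_smul]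
    congr 1
    simp [real_inner_comm]
    ring_nf
  · simp only [monoExpSign_eq, smul_mul_assoc]
    congr 2
    simp only [Pi.sub_apply, Function.comp_apply, Complex.ofRealCLM_apply, real_inner_comm]
    push_cast
    ring

/-- The Dirac operator as a functional of the derivative. -/
def diracCLM (m : ℕ) : (ParaVec m →L[ℝ] Cliff m) →L[ℝ] Cliff m :=
  ContinuousLinearMap.apply ℝ (Cliff m) (1, 0) +
    ∑ k, ((mulL m (e k)).restrictScalars ℝ).comp
      (ContinuousLinearMap.apply ℝ (Cliff m) (0, EuclideanSpace.single k 1))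

theorem diracOp_eq (F : ParaVec m → Cliff m) (x : ParaVec m) :
    diracOp F x = diracCLM m (fderiv ℝ F x) := by
  simp [diracOp, diracCLM]

/-- On e^s(x,ξ)v the Dirac operator acts as left multiplication by iξ - s|ξ|, which annihilates χ_s.
-/
theorem diracCLM_monoExpDeriv {s : ℝ} (hs : s * s = 1) (x : ParaVec m)
    (ξ : EuclideanSpace ℝ (Fin m)) (v : Cliff m) :
    diracCLM m (monoExpDeriv s ξ (monoExpSign s x ξ * v)) = 0 := by
  have h1 : diracCLM m (monoExpDeriv s ξ (monoExpSign s x ξ * v)) =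
      Complex.I • (vec ξ * (monoExpSign s x ξ * v)) - (s * ‖ξ‖ : ℂ) • (monoExpSign s x ξ * v) := by
    generalize monoExpSign s x ξ * v = u
    simp only [diracCLM, add_apply, sum_apply,
      ContinuousLinearMap.comp_apply, ContinuousLinearMap.apply_apply, monoExpDeriv_apply,
      ContinuousLinearMap.coe_restrictScalars', mulL_apply, inner_zero_right, zero_smul, zero_sub,
      one_smul, sub_zero, vec, Finset.sum_mul, Finset.smul_sum]
    rw [add_comm, sub_eq_add_neg]
    congr 1
    · refine Finset.sum_congr rfl fun k _ => ?_
      have : inner ℝ ξ (EuclideanSpace.single k 1) = ξ k := by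
        simp [EuclideanSpace.inner_single_right]
      rw [this, ← Complex.coe_smul, mul_smul_comm, mul_smul_comm, smul_mul_assoc, smul_comm]
    · rw [← Complex.coe_smul]; push_cast; rfl
  rw [h1, monoExpSign_eq, smul_mul_assoc, mul_smul_comm, ← mul_assoc, smul_comm, ← smul_mul_assoc,
    I_smul_vec_mul_chi hs, smul_mul_assoc, smul_comm, sub_self]

end Derivative

theorem LeftMonogenicOn.add {F G : ParaVec m → Cliff m} {Ω : Set (ParaVec m)} (hΩ : IsOpen Ω)
    (hF : LeftMonogenicOn F Ω) (hG : LeftMonogenicOn G Ω) :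
    LeftMonogenicOn (fun x => F x + G x) Ω := by
  refine ⟨hF.1.add hG.1, fun x hx => ?_⟩
  have h1 := (hF.1.differentiableOn one_ne_zero).differentiableAt (hΩ.mem_nhds hx)
  have h2 := (hG.1.differentiableOn one_ne_zero).differentiableAt (hΩ.mem_nhds hx)
  rw [diracOp_eq, fderiv_fun_add h1 h2, map_add, ← diracOp_eq, ← diracOp_eq, hF.2 x hx, hG.2 x hx,
    add_zero]

theorem LeftMonogenicOn.const_smul {F : ParaVec m → Cliff m} {Ω : Set (ParaVec m)} (hΩ : IsOpen Ω)
    (hF : LeftMonogenicOn F Ω) (c : ℝ) : LeftMonogenicOn (fun x => c • F x) Ω := by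
  refine ⟨hF.1.const_smul c, fun x hx => ?_⟩
  have h1 := (hF.1.differentiableOn one_ne_zero).differentiableAt (hΩ.mem_nhds hx)
  rw [diracOp_eq, fderiv_fun_const_smul h1, map_smul, ← diracOp_eq, hF.2 x hx, smul_zero]

theorem LeftMonogenicOn.congr {F G : ParaVec m → Cliff m} {Ω : Set (ParaVec m)} (hΩ : IsOpen Ω)
    (hF : LeftMonogenicOn F Ω) (h : ∀ x ∈ Ω, G x = F x) : LeftMonogenicOn G Ω := by
  refine ⟨hF.1.congr h, fun x hx => ?_⟩
  have h1 : G =ᶠ[𝓝 x] F := Filter.eventuallyEq_of_mem (hΩ.mem_nhds hx) h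
  rw [diracOp_eq, h1.fderiv_eq,
    ← diracOp_eq, hF.2 x hx]

theorem MemWeighted.aestronglyMeasurable_monoExpDeriv {a : ℝ}
    {g : EuclideanSpace ℝ (Fin m) → Cliff m} (hg : MemWeighted a g) (s : ℝ) (x : ParaVec m) :
    AEStronglyMeasurable (fun ξ => monoExpDeriv s ξ (monoExpSign s x ξ * g ξ)) volume := by
  have h1 : AEStronglyMeasurable (fun ξ => (ξ, monoExpSign s x ξ * g ξ)) volume :=
    AEStronglyMeasurable.prodMk continuous_id.aestronglyMeasurable
      (hg.aestronglyMeasurable_monoExpSign_mul s x)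
  have h2 := (continuous_monoExpDeriv (m := m) s).comp_aestronglyMeasurable h1
  exact h2

theorem MemWeighted.leftMonogenicOn_sign [NeZero m] {a : ℝ}
    {g : EuclideanSpace ℝ (Fin m) → Cliff m} (hg : MemWeighted a g) (ha : 0 < a) {s : ℝ}
    (hs : s * s = 1) : LeftMonogenicOn (fun x => ∫ ξ, monoExpSign s x ξ * g ξ) (strip m a) := by
  have hmeas : ∀ x, AEStronglyMeasurable
      (fun ξ => monoExpDeriv s ξ (monoExpSign s x ξ * g ξ)) volume := fun x =>
    hg.aestronglyMeasurable_monoExpDeriv s x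
  have hbound : ∀ b : ℝ, ∀ x ∈ strip m b, ∀ ξ,
      ‖monoExpDeriv s ξ (monoExpSign s x ξ * g ξ)‖ ≤
        2 * (‖ξ‖ * (Real.exp (b * ‖ξ‖) * ‖g ξ‖)) := fun b x hx ξ => by
    refine (norm_monoExpDeriv_le hs ξ _).trans ?_
    gcongr
    refine (norm_monoExpSign_mul_le hs x ξ _).trans ?_
    gcongr
    exact le_of_lt hx
  have hderiv : ∀ x ∈ strip m a, HasFDerivAt (fun x => ∫ ξ, monoExpSign s x ξ * g ξ)
      (∫ ξ, monoExpDeriv s ξ (monoExpSign s x ξ * g ξ)) x := fun x hx => by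
    -- A majorant uniform in x exists only on the smaller strip |x_0| < b with b < a, which is a
    -- neighbourhood of x.
    obtain ⟨b, hxb, hba⟩ := exists_between (show |x.1| < a from hx)
    exact hasFDerivAt_integral_of_dominated_of_fderiv_le ((isOpen_strip m b).mem_nhds hxb)
      (.of_forall fun x => hg.aestronglyMeasurable_monoExpSign_mul s x)
      (hg.integrable_monoExpSign_mul ha hs hx) (hmeas x)
      (.of_forall fun ξ x hx => hbound b x hx ξ)
      ((hg.integrable_norm_mul_exp_mul_norm ha hba).const_mul 2)
      (.of_forall fun ξ x _ => hasFDerivAt_monoExpSign_mul s ξ _ x)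
  have hcont : ContinuousOn (fun x => ∫ ξ, monoExpDeriv s ξ (monoExpSign s x ξ * g ξ))
      (strip m a) := fun x hx => by
    obtain ⟨b, hxb, hba⟩ := exists_between (show |x.1| < a from hx)
    refine (continuousAt_of_dominated (.of_forall hmeas) ?_
      ((hg.integrable_norm_mul_exp_mul_norm ha hba).const_mul 2)
      (.of_forall fun ξ => ?_)).continuousWithinAt
    · filter_upwards [(isOpen_strip m b).mem_nhds hxb] with x hx
      exact .of_forall (hbound b x hx)
    · have h1 : ContinuousAt (fun x => (ξ, monoExpSign s x ξ * g ξ)) x :=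
        continuousAt_const.prodMk (hasFDerivAt_monoExpSign_mul s ξ _ x).continuousAt
      have h2 := ((continuous_monoExpDeriv (m := m) s).continuousAt).comp h1
      exact h2
  refine ⟨?_, fun x hx => ?_⟩
  · rw [← zero_add (1 : WithTop ℕ∞), contDiffOn_succ_iff_fderiv_of_isOpen (isOpen_strip m a)]
    refine ⟨fun x hx => (hderiv x hx).differentiableAt.differentiableWithinAt, by simp, ?_⟩
    rw [contDiffOn_zero]
    exact hcont.congr fun x hx => (hderiv x hx).fderiv
  · obtain ⟨b, hxb, hba⟩ := exists_between (show |x.1| < a from hx)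
    rw [diracOp_eq, (hderiv x hx).fderiv, ← ContinuousLinearMap.integral_comp_comm]
    · simp [diracCLM_monoExpDeriv hs]
    · exact ((hg.integrable_norm_mul_exp_mul_norm ha hba).const_mul 2).mono' (hmeas x)
        (.of_forall (hbound b x hxb))

theorem MemWeighted.leftMonogenicOn_synth [NeZero m] {a : ℝ}
    {g : EuclideanSpace ℝ (Fin m) → Cliff m} (hg : MemWeighted a g) (ha : 0 < a) :
    LeftMonogenicOn (synth g) (strip m a) := by
  refine (((hg.leftMonogenicOn_sign ha (s := 1) (by norm_num)).add (isOpen_strip m a)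
    (hg.leftMonogenicOn_sign ha (s := -1) (by norm_num))).const_smul (isOpen_strip m a)
      ((2 * Real.pi) ^ m)⁻¹).congr (isOpen_strip m a) fun x hx => ?_
  rw [synth, ← integral_add (hg.integrable_monoExpSign_mul ha (by norm_num) hx)
    (hg.integrable_monoExpSign_mul ha (by norm_num) hx)]
  simp only [monoExp, add_mul]

end Synthesis

/-! ### The norm identity and its polarization. -/

section NormIdentity

open Cliff

variable {m : ℕ}

theorem restrict_strip (m : ℕ) (a : ℝ) :
    (volume : Measure (ParaVec m)).restrict (strip m a) =
      (volume.restrict (Set.Ioo (-a) a)).prod volume := by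
  have h : strip m a = Set.Ioo (-a) a ×ˢ Set.univ := by
    ext x; simp [strip, abs_lt]
  rw [h, Measure.volume_eq_prod, ← Measure.prod_restrict, Measure.restrict_univ]

theorem ae_restrict_Ioo_abs_lt (a : ℝ) :
    ∀ᵐ t ∂(volume : Measure ℝ).restrict (Set.Ioo (-a) a), |t| < a :=
  (ae_restrict_mem measurableSet_Ioo).mono fun _ ht => abs_lt.2 ht

theorem integrable_norm_sq_of_memLp {α : Type*} [MeasurableSpace α] {μ : Measure α}
    {u : α → Cliff m} (hu : MemLp u 2 μ) : Integrable (fun y => ‖u y‖ ^ 2) μ :=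
  (memLp_two_iff_integrable_sq_norm hu.1).1 hu

theorem IsFourierL2.integral_norm_sq {u g : EuclideanSpace ℝ (Fin m) → Cliff m}
    (h : IsFourierL2 u g) :
    ∫ y, ‖u y‖ ^ 2 = ((2 * Real.pi) ^ m)⁻¹ * ∫ ξ, ‖g ξ‖ ^ 2 := by
  have h1 := h.integral_inner h
  have h2 : ∀ x : Cliff m, inner ℂ x x = ((‖x‖ ^ 2 : ℝ) : ℂ) := fun x => by
    rw [inner_self_eq_norm_sq_to_K]; push_cast; rfl
  simp only [h2, integral_complex_ofReal, Complex.real_smul] at h1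
  exact_mod_cast h1

theorem IsFourierL2.lintegral_norm_sq {u g : EuclideanSpace ℝ (Fin m) → Cliff m}
    (h : IsFourierL2 u g) :
    ∫⁻ y, ENNReal.ofReal (‖u y‖ ^ 2) =
      ENNReal.ofReal ((2 * Real.pi) ^ m)⁻¹ * ∫⁻ ξ, ENNReal.ofReal (‖g ξ‖ ^ 2) := by
  rw [← ofReal_integral_eq_lintegral_ofReal (integrable_norm_sq_of_memLp h.memLp_left)
      (.of_forall fun _ => by positivity),
    ← ofReal_integral_eq_lintegral_ofReal (integrable_norm_sq_of_memLp h.memLp_right)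
      (.of_forall fun _ => by positivity), h.integral_norm_sq, ENNReal.ofReal_mul (by positivity)]

theorem aestronglyMeasurable_monoExp_mul_prod {g : EuclideanSpace ℝ (Fin m) → Cliff m}
    (hg : AEStronglyMeasurable g volume) (μ : Measure ℝ) [SFinite μ] :
    AEStronglyMeasurable
      (fun p : ℝ × EuclideanSpace ℝ (Fin m) => monoExp (p.1, 0) p.2 * g p.2) (μ.prod volume) := by
  have h1 : Measurable fun p : ℝ × EuclideanSpace ℝ (Fin m) =>
      (((p.1, 0) : ParaVec m), p.2) := by fun_prop
  have h2 := (stronglyMeasurable_monoExp (m := m)).comp_measurable h1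
  have h3 := h2.aestronglyMeasurable.mul (μ := μ.prod volume) hg.comp_snd
  exact h3

/-- Tonelli: for fixed ξ the t-integral produces the weight. No finiteness is assumed, so the
identity can later be used to deduce it. -/
theorem lintegral_lintegral_monoExp_mul [NeZero m] {a : ℝ} (ha : 0 < a)
    {g : EuclideanSpace ℝ (Fin m) → Cliff m} (hg : AEStronglyMeasurable g volume) :
    ∫⁻ t in Set.Ioo (-a) a, ∫⁻ ξ, ENNReal.ofReal (‖monoExp (t, 0) ξ * g ξ‖ ^ 2) =
      ∫⁻ ξ, ENNReal.ofReal (bergmanWeight a ξ * ‖g ξ‖ ^ 2) := by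
  have hm : AEMeasurable (Function.uncurry fun (t : ℝ) (ξ : EuclideanSpace ℝ (Fin m)) =>
      ENNReal.ofReal (‖monoExp (t, 0) ξ * g ξ‖ ^ 2))
      ((volume.restrict (Set.Ioo (-a) a)).prod volume) :=
    ((aestronglyMeasurable_monoExp_mul_prod hg _).norm.pow 2).aemeasurable.ennreal_ofReal
  rw [lintegral_lintegral_swap hm]
  refine lintegral_congr_ae ?_
  filter_upwards [ae_ne_zero] with ξ hξ
  exact lintegral_norm_sq_monoExp_mul ha hξ _

/-- The norm identity for functions whose slices have Fourier transforms `e(t, ·) g`. -/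
theorem lintegral_strip_norm_sq [NeZero m] {a : ℝ} (ha : 0 < a)
    {g : EuclideanSpace ℝ (Fin m) → Cliff m} (hg : AEStronglyMeasurable g volume)
    {F : ParaVec m → Cliff m} (hF : AEStronglyMeasurable F (volume.restrict (strip m a)))
    (h : ∀ᵐ t ∂(volume : Measure ℝ).restrict (Set.Ioo (-a) a),
      IsFourierL2 (fun y => F (t, y)) (fun ξ => monoExp (t, 0) ξ * g ξ)) :
    ∫⁻ x in strip m a, ENNReal.ofReal (‖F x‖ ^ 2) =
      ENNReal.ofReal ((2 * Real.pi) ^ m)⁻¹ *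
        ∫⁻ ξ, ENNReal.ofReal (bergmanWeight a ξ * ‖g ξ‖ ^ 2) := by
  rw [restrict_strip] at hF ⊢
  have hm : AEMeasurable (fun x => ENNReal.ofReal (‖F x‖ ^ 2))
      ((volume.restrict (Set.Ioo (-a) a)).prod volume) :=
    (hF.norm.pow 2).aemeasurable.ennreal_ofReal
  rw [lintegral_prod _ hm, ← lintegral_lintegral_monoExp_mul ha hg, ← lintegral_const_mul' _ _ ENNReal.ofReal_ne_top]
  refine lintegral_congr_ae ?_
  filter_upwards [h] with t ht
  exact ht.lintegral_norm_sq

theorem MemWeighted.lintegral_lt_top {a : ℝ} {g : EuclideanSpace ℝ (Fin m) → Cliff m}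
    (hg : MemWeighted a g) :
    ∫⁻ ξ, ENNReal.ofReal (bergmanWeight a ξ * ‖g ξ‖ ^ 2) < ⊤ :=
  hg.2.lintegral_lt_top

theorem memWeighted_of_lintegral_lt_top {a : ℝ} (ha : 0 < a)
    {g : EuclideanSpace ℝ (Fin m) → Cliff m} (hg : AEStronglyMeasurable g volume)
    (h : ∫⁻ ξ, ENNReal.ofReal (bergmanWeight a ξ * ‖g ξ‖ ^ 2) < ⊤) : MemWeighted a g := by
  refine ⟨hg, ((measurable_bergmanWeight a).aestronglyMeasurable.mul (hg.norm.pow 2)), ?_⟩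
  rw [hasFiniteIntegral_iff_ofReal]
  · exact h
  · exact .of_forall fun ξ => mul_nonneg (bergmanWeight_nonneg ha ξ) (by positivity)

theorem LeftMonogenicOn.aestronglyMeasurable {a : ℝ} {F : ParaVec m → Cliff m}
    (hF : LeftMonogenicOn F (strip m a)) :
    AEStronglyMeasurable F (volume.restrict (strip m a)) :=
  hF.1.continuousOn.aestronglyMeasurable (isOpen_strip m a).measurableSet

theorem MemWeighted.ae_isFourierL2_synth [NeZero m] {a : ℝ}
    {g : EuclideanSpace ℝ (Fin m) → Cliff m} (hg : MemWeighted a g) (ha : 0 < a) :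
    ∀ᵐ t ∂(volume : Measure ℝ).restrict (Set.Ioo (-a) a),
      IsFourierL2 (fun y => synth g (t, y)) (fun ξ => monoExp (t, 0) ξ * g ξ) := by
  filter_upwards [ae_restrict_Ioo_abs_lt a] with t ht
  exact hg.isFourierL2_synth ha ht

theorem MemWeighted.memBergman_synth [NeZero m] {a : ℝ}
    {g : EuclideanSpace ℝ (Fin m) → Cliff m} (hg : MemWeighted a g) (ha : 0 < a) :
    MemBergman a (synth g) := by
  have hF := hg.leftMonogenicOn_synth ha
  refine ⟨hF, hF.aestronglyMeasurable.norm.pow 2, ?_⟩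
  rw [hasFiniteIntegral_iff_ofReal (.of_forall fun ξ => by positivity),
    lintegral_strip_norm_sq ha hg.1 hF.aestronglyMeasurable (hg.ae_isFourierL2_synth ha)]
  exact ENNReal.mul_lt_top ENNReal.ofReal_lt_top hg.lintegral_lt_top

theorem MemWeighted.bergmanNormSq_synth [NeZero m] {a : ℝ}
    {g : EuclideanSpace ℝ (Fin m) → Cliff m} (hg : MemWeighted a g) (ha : 0 < a) :
    ((2 * Real.pi) ^ m)⁻¹ * ∫ ξ, bergmanWeight a ξ * ‖g ξ‖ ^ 2 = bergmanNormSq a (synth g) := by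
  have hF := (hg.memBergman_synth ha)
  have h := lintegral_strip_norm_sq ha hg.1 hF.1.aestronglyMeasurable (hg.ae_isFourierL2_synth ha)
  have h0 : 0 ≤ ∫ ξ, bergmanWeight a ξ * ‖g ξ‖ ^ 2 :=
    integral_nonneg fun ξ => mul_nonneg (bergmanWeight_nonneg ha ξ) (by positivity)
  rw [← ofReal_integral_eq_lintegral_ofReal hF.2 (.of_forall fun _ => by positivity),
    ← ofReal_integral_eq_lintegral_ofReal hg.2 (.of_forall fun ξ =>
      mul_nonneg (bergmanWeight_nonneg ha ξ) (by positivity)),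
    ← ENNReal.ofReal_mul (by positivity),
    ENNReal.ofReal_eq_ofReal_iff (integral_nonneg fun _ => by positivity) (by positivity)] at h
  exact h.symm

theorem integrable_inner_of_norm_sq {α : Type*} [MeasurableSpace α] {μ : Measure α}
    {u v : α → Cliff m} (hu : AEStronglyMeasurable u μ) (hv : AEStronglyMeasurable v μ)
    (hu2 : Integrable (fun x => ‖u x‖ ^ 2) μ) (hv2 : Integrable (fun x => ‖v x‖ ^ 2) μ) :
    Integrable (fun x => inner ℂ (u x) (v x)) μ := by
  refine (hu2.add hv2).mono' (hu.inner hv) (.of_forall fun x => ?_)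
  refine (norm_inner_le_norm _ _).trans ?_
  simp only [Pi.add_apply]
  nlinarith [sq_nonneg (‖u x‖ - ‖v x‖), sq_nonneg (‖u x‖ + ‖v x‖)]

theorem MemWeighted.integrable_norm_sq_monoExp_mul [NeZero m] {a : ℝ}
    {g : EuclideanSpace ℝ (Fin m) → Cliff m} (hg : MemWeighted a g) (ha : 0 < a) :
    Integrable (fun p : ℝ × EuclideanSpace ℝ (Fin m) => ‖monoExp (p.1, 0) p.2 * g p.2‖ ^ 2)
      ((volume.restrict (Set.Ioo (-a) a)).prod volume) := by
  have hm : AEStronglyMeasurable (fun p : ℝ × EuclideanSpace ℝ (Fin m) =>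
      ‖monoExp (p.1, 0) p.2 * g p.2‖ ^ 2) ((volume.restrict (Set.Ioo (-a) a)).prod volume) :=
    (aestronglyMeasurable_monoExp_mul_prod hg.1 _).norm.pow 2
  refine ⟨hm, ?_⟩
  rw [hasFiniteIntegral_iff_ofReal (.of_forall fun ξ => by positivity),
    lintegral_prod _ hm.aemeasurable.ennreal_ofReal]
  have h := lintegral_lintegral_monoExp_mul ha hg.1
  exact h.trans_lt hg.lintegral_lt_top

/-- The polarized norm identity. -/
theorem MemWeighted.integral_inner_synth [NeZero m] {a : ℝ}
    {g k : EuclideanSpace ℝ (Fin m) → Cliff m} (hg : MemWeighted a g) (hk : MemWeighted a k)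
    (ha : 0 < a) :
    ∫ x in strip m a, inner ℂ (synth k x) (synth g x) =
      (((2 * Real.pi) ^ m)⁻¹ : ℝ) • ∫ ξ, (bergmanWeight a ξ : ℂ) * inner ℂ (k ξ) (g ξ) := by
  have hF := hg.memBergman_synth ha
  have hH := hk.memBergman_synth ha
  have hi := integrable_inner_of_norm_sq hH.1.aestronglyMeasurable hF.1.aestronglyMeasurable
    hH.2 hF.2
  rw [restrict_strip] at hi ⊢
  rw [integral_prod _ hi]
  have h1 : ∫ t in Set.Ioo (-a) a, ∫ y, inner ℂ (synth k (t, y)) (synth g (t, y)) =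
      ∫ t in Set.Ioo (-a) a, (((2 * Real.pi) ^ m)⁻¹ : ℝ) •
        ∫ ξ, inner ℂ (monoExp (t, 0) ξ * k ξ) (monoExp (t, 0) ξ * g ξ) := by
    refine integral_congr_ae ?_
    filter_upwards [hg.ae_isFourierL2_synth ha, hk.ae_isFourierL2_synth ha] with t h1 h2
    exact h2.integral_inner h1
  have hi2 := integrable_inner_of_norm_sq
    (aestronglyMeasurable_monoExp_mul_prod hk.1 (volume.restrict (Set.Ioo (-a) a)))
    (aestronglyMeasurable_monoExp_mul_prod hg.1 _)
    (hk.integrable_norm_sq_monoExp_mul ha) (hg.integrable_norm_sq_monoExp_mul ha)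
  have h2 := integral_integral_swap (f := fun (t : ℝ) (ξ : EuclideanSpace ℝ (Fin m)) =>
    inner ℂ (monoExp (t, 0) ξ * k ξ) (monoExp (t, 0) ξ * g ξ)) hi2
  rw [h1, integral_smul, h2]
  congr 1
  refine integral_congr_ae ?_
  filter_upwards [ae_ne_zero] with ξ hξ
  exact setIntegral_inner_monoExp_mul ha hξ _ _

end NormIdentity

/-! ### Divergence theorem on a slab and the cut-off form of Cauchy's theorem. -/

section Stokes

open Cliff Filter Topology

variable {m : ℕ}

/-- Integration by parts against the constant function 1. -/
theorem integral_fderiv_eq_zero_of_hasCompactSupport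
    {G : EuclideanSpace ℝ (Fin m) → ℂ} (hG : ContDiff ℝ 1 G) (hGc : HasCompactSupport G)
    (v : EuclideanSpace ℝ (Fin m)) : ∫ y, fderiv ℝ G y v = 0 := by
  have hd : Continuous fun y => fderiv ℝ G y v :=
    (hG.continuous_fderiv one_ne_zero).clm_apply continuous_const
  have hdc : HasCompactSupport fun y => fderiv ℝ G y v := hGc.fderiv_apply (𝕜 := ℝ) v
  have h := integral_mul_fderiv_eq_neg_fderiv_mul_of_integrable (μ := volume) (𝕜 := ℂ)
    (f := fun _ : EuclideanSpace ℝ (Fin m) => (1 : ℂ)) (g := G) (v := v)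
    (by simp) (by simpa using hd.integrable_of_hasCompactSupport hdc)
    (by simpa using hG.continuous.integrable_of_hasCompactSupport hGc)
    (fun _ _ => by fun_prop) (fun y _ => (hG.differentiable one_ne_zero) y)
  simpa using h

theorem hasCompactSupport_slice {F : Type*} [Zero F] [TopologicalSpace F] {G : ParaVec m → F}
    (hGc : HasCompactSupport G) (t : ℝ) : HasCompactSupport fun y => G (t, y) :=
  HasCompactSupport.intro (hGc.isCompact.image continuous_snd) fun y hy => by
    by_contra h
    exact hy ⟨(t, y), subset_tsupport _ h, rfl⟩

theorem restrict_Ioc_prod_univ (m : ℕ) (s t : ℝ) :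
    (volume : Measure (ParaVec m)).restrict (Set.Ioc s t ×ˢ Set.univ) =
      (volume.restrict (Set.Ioc s t)).prod volume := by
  rw [Measure.volume_eq_prod, ← Measure.prod_restrict, Measure.restrict_univ]

variable {G : ParaVec m → ℂ}

theorem setIntegral_fderiv_snd (hG : ContDiff ℝ 1 G) (hGc : HasCompactSupport G) (s t : ℝ)
    (v : EuclideanSpace ℝ (Fin m)) :
    ∫ x in Set.Ioc s t ×ˢ Set.univ, fderiv ℝ G x (0, v) = 0 := by
  have hd : Continuous fun x => fderiv ℝ G x (0, v) :=
    (hG.continuous_fderiv one_ne_zero).clm_apply continuous_const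
  have hi : Integrable (fun x => fderiv ℝ G x (0, v)) :=
    hd.integrable_of_hasCompactSupport (hGc.fderiv_apply (𝕜 := ℝ) (0, v))
  have hi' := hi.restrict (s := Set.Ioc s t ×ˢ Set.univ)
  rw [restrict_Ioc_prod_univ] at hi' ⊢
  rw [integral_prod _ hi']
  have : ∀ τ : ℝ, ∫ y, fderiv ℝ G (τ, y) (0, v) = 0 := fun τ => by
    have h1 : ContDiff ℝ 1 fun y => G (τ, y) := hG.comp (contDiff_prodMk_right τ)
    rw [← integral_fderiv_eq_zero_of_hasCompactSupport h1 (hasCompactSupport_slice hGc τ) v]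
    refine integral_congr_ae (.of_forall fun y => ?_)
    have h2 : HasFDerivAt (fun y => G (τ, y)) ((fderiv ℝ G (τ, y)).comp
        (ContinuousLinearMap.inr ℝ ℝ (EuclideanSpace ℝ (Fin m)))) y :=
      ((hG.differentiable one_ne_zero) (τ, y)).hasFDerivAt.comp y (hasFDerivAt_prodMk_right τ y)
    simp only [h2.fderiv]
    simp
  simp [this]

/-- Fubini, then the fundamental theorem of calculus along each line y = const. -/
theorem setIntegral_fderiv_fst (hG : ContDiff ℝ 1 G) (hGc : HasCompactSupport G) {s t : ℝ}
    (hst : s ≤ t) :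
    ∫ x in Set.Ioc s t ×ˢ Set.univ, fderiv ℝ G x (1, 0) =
      (∫ y, G (t, y)) - ∫ y, G (s, y) := by
  have hd : Continuous fun x => fderiv ℝ G x (1, 0) :=
    (hG.continuous_fderiv one_ne_zero).clm_apply continuous_const
  have hi : Integrable (fun x => fderiv ℝ G x (1, 0)) :=
    hd.integrable_of_hasCompactSupport (hGc.fderiv_apply (𝕜 := ℝ) (1, 0))
  have hi' := hi.restrict (s := Set.Ioc s t ×ˢ Set.univ)
  have hs : ∀ τ : ℝ, Integrable fun y => G (τ, y) := fun τ =>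
    (hG.continuous.comp (by fun_prop)).integrable_of_hasCompactSupport
      (hasCompactSupport_slice hGc τ)
  rw [restrict_Ioc_prod_univ] at hi' ⊢
  rw [integral_prod_symm _ hi', ← integral_sub (hs t) (hs s)]
  refine integral_congr_ae (.of_forall fun y => ?_)
  simp only
  rw [← intervalIntegral.integral_of_le hst]
  refine intervalIntegral.integral_eq_sub_of_hasDerivAt (f := fun τ => G (τ, y)) (fun τ _ => ?_) ?_
  · have h2 : HasFDerivAt (fun τ => G (τ, y)) ((fderiv ℝ G (τ, y)).comp
        (ContinuousLinearMap.inl ℝ ℝ (EuclideanSpace ℝ (Fin m)))) τ :=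
      ((hG.differentiable one_ne_zero) (τ, y)).hasFDerivAt.comp τ (hasFDerivAt_prodMk_left τ y)
    simpa using h2.hasDerivAt
  · exact (hd.comp (by fun_prop : Continuous fun τ : ℝ => ((τ, y) : ParaVec m))).intervalIntegrable _ _

/-- The reflection `(x_0, y) ↦ (-x_0, y)`. -/
def reflect (m : ℕ) : ParaVec m →L[ℝ] ParaVec m :=
  (-ContinuousLinearMap.fst ℝ ℝ (EuclideanSpace ℝ (Fin m))).prod
    (ContinuousLinearMap.snd ℝ ℝ (EuclideanSpace ℝ (Fin m)))

@[simp] theorem reflect_apply (x : ParaVec m) : reflect m x = (-x.1, x.2) := rfl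

theorem reflect_mem_strip {a : ℝ} {x : ParaVec m} (hx : x ∈ strip m a) :
    reflect m x ∈ strip m a := by
  simpa [strip] using hx

section Cutoff

variable {a : ℝ} {H f : ParaVec m → Cliff m} {χ : ParaVec m → ℝ}

theorem LeftMonogenicOn.differentiableAt (hf : LeftMonogenicOn f (strip m a)) {x : ParaVec m}
    (hx : x ∈ strip m a) : DifferentiableAt ℝ f x :=
  (hf.1.differentiableOn one_ne_zero).differentiableAt ((isOpen_strip m a).mem_nhds hx)

theorem LeftMonogenicOn.contDiffOn_reflect (hf : LeftMonogenicOn f (strip m a)) :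
    ContDiffOn ℝ 1 (fun x => f (reflect m x)) (strip m a) :=
  hf.1.comp (reflect m).contDiff.contDiffOn fun _ hx => reflect_mem_strip hx

/-- P is regular only on the strip; off the strip χ vanishes in a neighbourhood, so the product is
locally zero whatever P is there. -/
theorem contDiff_smul_of_tsupport_subset {P : ParaVec m → ℂ} (hχ : ContDiff ℝ 1 χ)
    (hχs : tsupport χ ⊆ strip m a) (hP : ContDiffOn ℝ 1 P (strip m a)) :
    ContDiff ℝ 1 fun x => χ x • P x := by
  rw [contDiff_iff_contDiffAt]
  intro x
  by_cases hx : x ∈ strip m a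
  · exact hχ.contDiffAt.smul (hP.contDiffAt ((isOpen_strip m a).mem_nhds hx))
  · have h0 : χ =ᶠ[𝓝 x] 0 := notMem_tsupport_iff_eventuallyEq.1 fun h => hx (hχs h)
    refine (contDiffAt_const (c := (0 : ℂ))).congr_of_eventuallyEq ?_
    filter_upwards [h0] with y hy
    simp [hy]

theorem fderiv_smul_of_tsupport_subset {P : ParaVec m → ℂ} (hχ : ContDiff ℝ 1 χ)
    (hχs : tsupport χ ⊆ strip m a) (hP : ContDiffOn ℝ 1 P (strip m a)) (x v : ParaVec m) :
    fderiv ℝ (fun x => χ x • P x) x v = χ x • fderiv ℝ P x v + (fderiv ℝ χ x v) • P x := by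
  by_cases hx : x ∈ strip m a
  · have h1 := (hP.differentiableOn one_ne_zero).differentiableAt ((isOpen_strip m a).mem_nhds hx)
    have h2 := (hχ.differentiable one_ne_zero) x
    rw [fderiv_fun_smul h2 h1]
    simp
  · have h0 : χ =ᶠ[𝓝 x] 0 := notMem_tsupport_iff_eventuallyEq.1 fun h => hx (hχs h)
    have h1 : (fun x => χ x • P x) =ᶠ[𝓝 x] fun _ => 0 := by
      filter_upwards [h0] with y hy
      simp [hy]
    have h2 : χ =ᶠ[𝓝 x] fun _ => 0 := h0
    rw [h1.fderiv_eq, h2.fderiv_eq, h0.eq_of_nhds]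
    simp

/-- `∂_0 ⟨H(-x_0, y), f⟩ = ∑_k ∂_k ⟨e_k H(-x_0, y), f⟩` for left-monogenic `H` and `f`. -/
theorem fderiv_inner_reflect (hH : LeftMonogenicOn H (strip m a))
    (hf : LeftMonogenicOn f (strip m a)) {x : ParaVec m} (hx : x ∈ strip m a) :
    fderiv ℝ (fun x => inner ℂ (H (reflect m x)) (f x)) x (1, 0) =
      ∑ k, fderiv ℝ (fun x => inner ℂ (e k * H (reflect m x)) (f x)) x
        (0, EuclideanSpace.single k 1) := by
  have hf' := hf.differentiableAt hx
  have hHx := hH.differentiableAt (reflect_mem_strip hx)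
  have hR : HasFDerivAt (fun x => H (reflect m x))
      ((fderiv ℝ H (reflect m x)).comp (reflect m)) x :=
    hHx.hasFDerivAt.comp x (reflect m).hasFDerivAt
  have hRk : ∀ k, HasFDerivAt (fun x => e k * H (reflect m x))
      (((mulL m (e k)).restrictScalars ℝ).comp
        ((fderiv ℝ H (reflect m x)).comp (reflect m))) x := fun k =>
    ((mulL m (e k)).restrictScalars ℝ).hasFDerivAt.comp x hR
  have h1 := hf.2 x hx
  have h2 := hH.2 _ (reflect_mem_strip hx)
  rw [diracOp, add_eq_zero_iff_eq_neg] at h1 h2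
  simp only [fun k v => fderiv_inner_apply ℂ (hRk k).differentiableAt hf' v, (hRk _).fderiv]
  rw [fderiv_inner_apply ℂ hR.differentiableAt hf', hR.fderiv, h1]
  simp only [ContinuousLinearMap.comp_apply, reflect_apply,
    ContinuousLinearMap.coe_restrictScalars', mulL_apply, neg_zero]
  -- The reflection flips the sign of ∂_0 on H. Replacing both ∂_0-derivatives by -∑ e_k∂_k then
  -- gives ⟨e_k∂_kH, f⟩ - ⟨H, e_k∂_kf⟩, and skew-adjointness of e_k makes this the product rule for
  -- ⟨e_kH, f⟩.
  have h3 : ((-1, 0) : ParaVec m) = -(1, 0) := by simp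
  rw [h3, map_neg]
  rw [reflect_apply] at h2
  rw [h2, neg_neg, inner_neg_right, inner_sum, sum_inner, Finset.sum_add_distrib]
  congr 1
  rw [← Finset.sum_neg_distrib]
  exact Finset.sum_congr rfl fun k _ => by rw [inner_e_mul, neg_neg]

theorem norm_sum_fderiv_smul_inner_le {C : ℝ} {x : ParaVec m}
    (hC : ∀ k : Fin m, ‖fderiv ℝ χ x (0, EuclideanSpace.single k 1)‖ ≤ C) (u v : Cliff m) :
    ‖∑ k, fderiv ℝ χ x (0, EuclideanSpace.single k 1) • inner ℂ (e k * u) v‖ ≤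
      m * C * (‖u‖ * ‖v‖) := by
  refine (norm_sum_le _ _).trans ?_
  calc ∑ k, ‖fderiv ℝ χ x (0, EuclideanSpace.single k 1) • inner ℂ (e k * u) v‖
      ≤ ∑ _k : Fin m, C * (‖u‖ * ‖v‖) := by
        refine Finset.sum_le_sum fun k _ => ?_
        rw [norm_smul]
        have h0 : 0 ≤ C := (norm_nonneg _).trans (hC k)
        gcongr
        · exact hC k
        · exact (norm_inner_le_norm _ _).trans (by rw [norm_e_mul])
    _ = _ := by simp; ring

/-- Cauchy's theorem with a cut-off. -/
theorem norm_integral_sub_integral_le (hH : LeftMonogenicOn H (strip m a))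
    (hf : LeftMonogenicOn f (strip m a)) (hχ : ContDiff ℝ 1 χ) (hχc : HasCompactSupport χ)
    (hχs : tsupport χ ⊆ strip m a) {s t C : ℝ} (hst : s ≤ t) (hs : -a < s) (ht : t < a)
    (hχ0 : ∀ x : ParaVec m, x.1 ∈ Set.Ioc s t → fderiv ℝ χ x (1, 0) = 0)
    (hC : ∀ x, ∀ k : Fin m, ‖fderiv ℝ χ x (0, EuclideanSpace.single k 1)‖ ≤ C) (hC0 : 0 ≤ C)
    (hint : IntegrableOn (fun x => ‖H (reflect m x)‖ * ‖f x‖) (strip m a)) :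
    ‖(∫ y, χ (t, y) • inner ℂ (H (-t, y)) (f (t, y))) -
        ∫ y, χ (s, y) • inner ℂ (H (-s, y)) (f (s, y))‖ ≤
      m * C * ∫ x in strip m a, ‖H (reflect m x)‖ * ‖f x‖ := by
  have hRk : ∀ k, ContDiffOn ℝ 1 (fun x => inner ℂ (e k * H (reflect m x)) (f x)) (strip m a) :=
    fun k => (((mulL m (e k)).restrictScalars ℝ).contDiff.comp_contDiffOn
      hH.contDiffOn_reflect).inner ℂ hf.1
  have hR : ContDiffOn ℝ 1 (fun x => inner ℂ (H (reflect m x)) (f x)) (strip m a) :=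
    hH.contDiffOn_reflect.inner ℂ hf.1
  have h1 := setIntegral_fderiv_fst (contDiff_smul_of_tsupport_subset hχ hχs hR)
    (hχc.smul_right) hst
  simp only [reflect_apply] at h1
  rw [← h1]
  have hGk := fun k => contDiff_smul_of_tsupport_subset hχ hχs (hRk k)
  have hGkc : ∀ k, HasCompactSupport fun x => χ x • inner ℂ (e k * H (reflect m x)) (f x) :=
    fun k => hχc.smul_right
  have hGki : ∀ k, Integrable (fun x => fderiv ℝ
      (fun x => χ x • inner ℂ (e k * H (reflect m x)) (f x)) x (0, EuclideanSpace.single k 1)) :=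
    fun k => (((hGk k).continuous_fderiv one_ne_zero).clm_apply
      continuous_const).integrable_of_hasCompactSupport ((hGkc k).fderiv_apply (𝕜 := ℝ) _)
  have h2 : ∫ x in Set.Ioc s t ×ˢ Set.univ, ∑ k, fderiv ℝ
      (fun x => χ x • inner ℂ (e k * H (reflect m x)) (f x)) x (0, EuclideanSpace.single k 1) =
      0 := by
    rw [integral_finsetSum _ fun k _ => (hGki k).restrict]
    exact Finset.sum_eq_zero fun k _ => setIntegral_fderiv_snd (hGk k) (hGkc k) s t _
  have hG0i : Integrable (fun x => fderiv ℝ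
      (fun x => χ x • inner ℂ (H (reflect m x)) (f x)) x (1, 0)) :=
    (((contDiff_smul_of_tsupport_subset hχ hχs hR).continuous_fderiv one_ne_zero).clm_apply
      continuous_const).integrable_of_hasCompactSupport
        ((hχc.smul_right : HasCompactSupport fun x =>
          χ x • inner ℂ (H (reflect m x)) (f x)).fderiv_apply (𝕜 := ℝ) _)
  have hsub : Set.Ioc s t ×ˢ Set.univ ⊆ strip m a := fun x hx =>
    abs_lt.2 ⟨hs.trans hx.1.1, hx.1.2.trans_lt ht⟩
  have h3 : ∫ x in Set.Ioc s t ×ˢ Set.univ, fderiv ℝ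
      (fun x => χ x • inner ℂ (H (reflect m x)) (f x)) x (1, 0) =
      ∫ x in Set.Ioc s t ×ˢ Set.univ, -∑ k, fderiv ℝ χ x (0, EuclideanSpace.single k 1) •
        inner ℂ (e k * H (reflect m x)) (f x) := by
    -- Subtracting the vanishing integral of the tangential divergence cancels all terms in which χ
    -- is not differentiated; as ∂_0χ = 0 on the slab, only the ∂_kχ terms survive.
    rw [← sub_zero (∫ x in Set.Ioc s t ×ˢ Set.univ, fderiv ℝ
      (fun x => χ x • inner ℂ (H (reflect m x)) (f x)) x (1, 0)), ← h2,
      ← integral_sub hG0i.restrict (integrable_finsetSum _ fun k _ => (hGki k).restrict)]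
    refine setIntegral_congr_fun (measurableSet_Ioc.prod MeasurableSet.univ) fun x hx => ?_
    simp only [fderiv_smul_of_tsupport_subset hχ hχs hR,
      fun k => fderiv_smul_of_tsupport_subset hχ hχs (hRk k), hχ0 x hx.1, zero_smul, add_zero,
      fderiv_inner_reflect hH hf (hsub hx), Finset.smul_sum, Finset.sum_add_distrib]
    abel
  simp only [reflect_apply] at h3 hint ⊢
  rw [h3, ← integral_const_mul]
  refine (norm_integral_le_of_norm_le ((hint.mono_set hsub).const_mul (m * C))
    (.of_forall fun x => ?_)).trans
    (setIntegral_mono_set (hint.const_mul _) (.of_forall fun x => ?_) hsub.eventuallyLE)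
  · rw [norm_neg]
    exact norm_sum_fderiv_smul_inner_le (hC x) _ _
  · simp only [Pi.zero_apply]; positivity

end Cutoff

end Stokes

/-! ### Removing the cut-off: conservation of the reflected pairing. -/

section Cauchy

open Cliff Filter Topology

variable {m : ℕ} {a : ℝ} {H f : ParaVec m → Cliff m}

theorem measurePreserving_reflect (m : ℕ) :
    MeasurePreserving (reflect m) (volume : Measure (ParaVec m)) volume := by
  have h := (Measure.measurePreserving_neg (volume : Measure ℝ)).prod
    (MeasurePreserving.id (volume : Measure (EuclideanSpace ℝ (Fin m))))
  exact h

theorem measurableEmbedding_reflect (m : ℕ) : MeasurableEmbedding (reflect m) :=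
  ((Homeomorph.neg ℝ).prodCongr (Homeomorph.refl (EuclideanSpace ℝ (Fin m)))).measurableEmbedding

theorem integrableOn_comp_reflect {F : ParaVec m → ℝ} (hF : IntegrableOn F (strip m a)) :
    IntegrableOn (fun x => F (reflect m x)) (strip m a) := by
  have h := ((measurePreserving_reflect m).integrableOn_comp_preimage
    (measurableEmbedding_reflect m) (f := F) (s := strip m a)).2 hF
  refine h.mono_set fun x hx => reflect_mem_strip hx

theorem MemBergman.integrableOn_norm_mul_norm (hH : MemBergman a H) (hf : MemBergman a f) :
    IntegrableOn (fun x => ‖H (reflect m x)‖ * ‖f x‖) (strip m a) := by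
  have h1 := integrableOn_comp_reflect hH.2
  have h2 : AEStronglyMeasurable (fun x => H (reflect m x)) (volume.restrict (strip m a)) :=
    hH.1.contDiffOn_reflect.continuousOn.aestronglyMeasurable (isOpen_strip m a).measurableSet
  refine (h1.add hf.2).mono' (h2.norm.mul hf.1.aestronglyMeasurable.norm) (.of_forall fun x => ?_)
  rw [Real.norm_of_nonneg (by positivity), Pi.add_apply]
  nlinarith [sq_nonneg (‖H (reflect m x)‖ - ‖f x‖), sq_nonneg (‖H (reflect m x)‖ + ‖f x‖)]

/-- The cut-off `θ(x_0) ρ(y / R)`. -/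
def cutoff (θ : ContDiffBump (0 : ℝ)) (ρ : ContDiffBump (0 : EuclideanSpace ℝ (Fin m))) (R : ℝ)
    (x : ParaVec m) : ℝ := θ x.1 * ρ (R⁻¹ • x.2)

section

variable (θ : ContDiffBump (0 : ℝ)) (ρ : ContDiffBump (0 : EuclideanSpace ℝ (Fin m))) {R : ℝ}

theorem contDiff_cutoff : ContDiff ℝ 1 (cutoff θ ρ R) := by
  unfold cutoff
  exact (θ.contDiff.comp contDiff_fst).mul (ρ.contDiff.comp (contDiff_snd.const_smul R⁻¹))

theorem hasCompactSupport_cutoff (hR : 0 < R) : HasCompactSupport (cutoff θ ρ R) := by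
  refine HasCompactSupport.intro ((isCompact_closedBall (0 : ℝ) θ.rOut).prod
    (isCompact_closedBall (0 : EuclideanSpace ℝ (Fin m)) (R * ρ.rOut))) fun x hx => ?_
  rw [cutoff]
  by_contra h
  obtain ⟨h1, h2⟩ := mul_ne_zero_iff.1 h
  refine hx ⟨?_, ?_⟩
  · exact Metric.ball_subset_closedBall (θ.support_eq ▸ h1)
  · have h3 : R⁻¹ • x.2 ∈ Metric.ball 0 ρ.rOut := ρ.support_eq ▸ h2
    rw [mem_ball_zero_iff, norm_smul, norm_inv, Real.norm_of_nonneg hR.le,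
      inv_mul_lt_iff₀ hR] at h3
    exact mem_closedBall_zero_iff.2 h3.le

theorem tsupport_cutoff_subset (ha : θ.rOut < a) : tsupport (cutoff θ ρ R) ⊆ strip m a := by
  have h : tsupport (cutoff θ ρ R) ⊆ {x | |x.1| ≤ θ.rOut} := by
    refine closure_minimal (fun x hx => ?_) (isClosed_le (by fun_prop) continuous_const)
    have h1 : x.1 ∈ Metric.ball 0 θ.rOut := θ.support_eq ▸ (mul_ne_zero_iff.1 hx).1
    exact (mem_ball_zero_iff.1 h1).le
  exact fun x hx => (h hx).trans_lt ha

theorem hasFDerivAt_cutoff (x : ParaVec m) :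
    HasFDerivAt (cutoff θ ρ R)
      (θ x.1 • (fderiv ℝ ρ (R⁻¹ • x.2)).comp
          (R⁻¹ • ContinuousLinearMap.snd ℝ ℝ (EuclideanSpace ℝ (Fin m))) +
        ρ (R⁻¹ • x.2) • (fderiv ℝ θ x.1).comp
          (ContinuousLinearMap.fst ℝ ℝ (EuclideanSpace ℝ (Fin m)))) x := by
  have h1 : HasFDerivAt (fun x : ParaVec m => θ x.1) ((fderiv ℝ θ x.1).comp
      (ContinuousLinearMap.fst ℝ ℝ (EuclideanSpace ℝ (Fin m)))) x :=
    ((θ.contDiff (n := 1)).differentiable one_ne_zero x.1).hasFDerivAt.comp x hasFDerivAt_fst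
  have h2 : HasFDerivAt (fun x : ParaVec m => ρ (R⁻¹ • x.2)) ((fderiv ℝ ρ (R⁻¹ • x.2)).comp
      (R⁻¹ • ContinuousLinearMap.snd ℝ ℝ (EuclideanSpace ℝ (Fin m)))) x :=
    HasFDerivAt.comp (g := ρ) x
      ((ρ.contDiff (n := 1)).differentiable one_ne_zero (R⁻¹ • x.2)).hasFDerivAt
      (R⁻¹ • ContinuousLinearMap.snd ℝ ℝ (EuclideanSpace ℝ (Fin m))).hasFDerivAt
  exact h1.mul h2

/-- On |x_0| < `θ.rIn` the factor θ is locally 1, so the cut-off contributes no normal derivative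
between the slices. -/
theorem fderiv_cutoff_fst {x : ParaVec m} (hx : |x.1| < θ.rIn) :
    fderiv ℝ (cutoff θ ρ R) x (1, 0) = 0 := by
  have h : (θ : ℝ → ℝ) =ᶠ[𝓝 x.1] fun _ => 1 :=
    θ.eventuallyEq_one_of_mem_ball (mem_ball_zero_iff.2 hx)
  rw [(hasFDerivAt_cutoff θ ρ x).fderiv, h.fderiv_eq]
  simp

/-- The factor 1/R, from the chain rule, makes the error in Cauchy's theorem vanish as R → ∞. -/
theorem norm_fderiv_cutoff_snd_le {M : ℝ} (hM : ∀ y, ‖fderiv ℝ ρ y‖ ≤ M) (hR : 0 < R)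
    (x : ParaVec m) (k : Fin m) :
    ‖fderiv ℝ (cutoff θ ρ R) x (0, EuclideanSpace.single k 1)‖ ≤ M * R⁻¹ := by
  rw [(hasFDerivAt_cutoff θ ρ x).fderiv]
  simp only [add_apply, smul_apply, ContinuousLinearMap.comp_apply,
    ContinuousLinearMap.coe_snd', ContinuousLinearMap.coe_fst', map_zero, smul_zero, add_zero,
    map_smul, norm_smul]
  have h1 : ‖θ x.1‖ ≤ 1 := by
    rw [Real.norm_of_nonneg θ.nonneg]; exact θ.le_one
  have h2 : ‖fderiv ℝ ρ (R⁻¹ • x.2) (EuclideanSpace.single k 1)‖ ≤ M := by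
    refine (ContinuousLinearMap.le_opNorm _ _).trans ?_
    rw [PiLp.norm_single, norm_one, mul_one]
    exact hM _
  rw [Real.norm_of_nonneg (inv_nonneg.2 hR.le)]
  calc _ ≤ 1 * (R⁻¹ * M) := by gcongr
    _ = _ := by ring

end

theorem tendsto_integral_cutoff_smul (θ : ContDiffBump (0 : ℝ))
    (ρ : ContDiffBump (0 : EuclideanSpace ℝ (Fin m))) {t : ℝ} (ht : |t| < θ.rIn)
    {P : EuclideanSpace ℝ (Fin m) → ℂ} (hP : Integrable P) :
    Tendsto (fun n : ℕ => ∫ y, cutoff θ ρ ((n : ℝ) + 1) (t, y) • P y) atTop (𝓝 (∫ y, P y)) := by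
  have hθ : θ t = 1 := θ.one_of_mem_closedBall (mem_closedBall_zero_iff.2 ht.le)
  refine tendsto_integral_of_dominated_convergence (fun y => ‖P y‖) (fun n => ?_) hP.norm
    (fun n => .of_forall fun y => ?_) (.of_forall fun y => ?_)
  · have h : Continuous fun y : EuclideanSpace ℝ (Fin m) => cutoff θ ρ ((n : ℝ) + 1) (t, y) :=
      (contDiff_cutoff θ ρ).continuous.comp (by fun_prop)
    exact h.aestronglyMeasurable.smul hP.1
  · rw [norm_smul, cutoff, hθ, one_mul, Real.norm_of_nonneg ρ.nonneg]
    exact mul_le_of_le_one_left (norm_nonneg _) ρ.le_one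
  · have h1 : Tendsto (fun n : ℕ => ((n : ℝ) + 1)⁻¹ • y) atTop (𝓝 ((0 : ℝ) • y)) := by
      simpa only [one_div] using
        (tendsto_one_div_add_atTop_nhds_zero_nat (𝕜 := ℝ)).smul_const y
    rw [zero_smul] at h1
    have h2 : ∀ᶠ n : ℕ in atTop, ρ (((n : ℝ) + 1)⁻¹ • y) = 1 :=
      h1.eventually (ρ.eventuallyEq_one_of_mem_ball (Metric.mem_ball_self ρ.rIn_pos))
    refine tendsto_const_nhds.congr' ?_
    filter_upwards [h2] with n hn
    simp [cutoff, hθ, hn]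

/-- Cauchy's theorem on the strip: the pairing `∫ ⟨H(-t, y), f(t, y)⟩ dy` of two functions in the
Bergman space does not depend on `t`. -/
theorem MemBergman.integral_inner_slice_eq (hH : MemBergman a H) (hf : MemBergman a f) {s t : ℝ}
    (hs : |s| < a) (ht : |t| < a)
    (his : Integrable fun y => inner ℂ (H (-s, y)) (f (s, y)))
    (hit : Integrable fun y => inner ℂ (H (-t, y)) (f (t, y))) :
    ∫ y, inner ℂ (H (-s, y)) (f (s, y)) = ∫ y, inner ℂ (H (-t, y)) (f (t, y)) := by
  wlog hst : s ≤ t generalizing s t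
  · exact (this ht hs hit his (le_of_not_ge hst)).symm
  -- The radii satisfy max(|s|,|t|) < b < b' < a: θ is 1 near both slices and the slab between them,
  -- and its support stays inside the strip.
  obtain ⟨b', hb', hb'a⟩ := exists_between (max_lt hs ht)
  obtain ⟨b, hb, hbb'⟩ := exists_between hb'
  obtain ⟨hsb, htb⟩ := max_lt_iff.1 hb
  let θ : ContDiffBump (0 : ℝ) := ⟨b, b', (abs_nonneg s).trans_lt hsb, hbb'⟩
  let ρ : ContDiffBump (0 : EuclideanSpace ℝ (Fin m)) := ⟨1, 2, one_pos, one_lt_two⟩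
  obtain ⟨M, hM⟩ := ((ρ.contDiff (n := 1)).continuous_fderiv
    one_ne_zero).bounded_above_of_compact_support (ρ.hasCompactSupport.fderiv (𝕜 := ℝ))
  have hM0 : 0 ≤ M := (norm_nonneg _).trans (hM 0)
  set N := ∫ x in strip m a, ‖H (reflect m x)‖ * ‖f x‖
  have h1 := ((tendsto_integral_cutoff_smul θ ρ htb hit).sub
    (tendsto_integral_cutoff_smul θ ρ hsb his)).norm
  have h2 : Tendsto (fun n : ℕ => m * (M * ((n : ℝ) + 1)⁻¹) * N) atTop
      (𝓝 (m * (M * 0) * N)) := by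
    have := tendsto_one_div_add_atTop_nhds_zero_nat (𝕜 := ℝ)
    simp only [one_div] at this
    exact ((this.const_mul M).const_mul _).mul_const N
  -- With R = n + 1 the difference of the cut-off pairings is at most mMN/(n+1), where N is the
  -- integral of a function integrable because both H and f are square-integrable.
  have h3 := le_of_tendsto_of_tendsto' h1 h2 fun n => by
    have hR : (0 : ℝ) < (n : ℝ) + 1 := by positivity
    refine norm_integral_sub_integral_le hH.1 hf.1 (contDiff_cutoff θ ρ)
      (hasCompactSupport_cutoff θ ρ hR) (tsupport_cutoff_subset θ ρ hb'a) hst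
      (abs_lt.1 hs).1 (abs_lt.1 ht).2 (fun x hx => ?_)
      (fun x k => norm_fderiv_cutoff_snd_le θ ρ hM hR x k) (by positivity)
      (hH.integrableOn_norm_mul_norm hf)
    refine fderiv_cutoff_fst θ ρ (abs_lt.2 ⟨?_, ?_⟩)
    · exact (abs_lt.1 hsb).1.trans hx.1
    · exact hx.2.trans_lt (abs_lt.1 htb).2
  rw [mul_zero, mul_zero, zero_mul] at h3
  exact (sub_eq_zero.1 (norm_le_zero_iff.1 h3)).symm

end Cauchy

/-! ### Every Bergman function is synthesized from its spectrum. -/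

section Analysis

open Cliff Filter Topology

variable {m : ℕ} {a : ℝ} {f : ParaVec m → Cliff m}

theorem bergmanWeight_le (ha : 0 < a) (ξ : EuclideanSpace ℝ (Fin m)) :
    bergmanWeight a ξ ≤ 2 * a * Real.exp (2 * a * ‖ξ‖) := by
  by_cases hξ : ξ = 0
  · simp [hξ, bergmanWeight, ha.le]
  have hr : 0 < ‖ξ‖ := norm_pos_iff.2 hξ
  rw [bergmanWeight, div_le_iff₀ (by positivity)]
  have h1 := Real.add_one_le_exp (-(2 * (2 * a * ‖ξ‖)))
  have h2 : Real.exp (-(2 * a * ‖ξ‖)) =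
      Real.exp (2 * a * ‖ξ‖) * Real.exp (-(2 * (2 * a * ‖ξ‖))) := by
    rw [← Real.exp_add]; congr 1; ring
  rw [h2]
  nlinarith [Real.exp_pos (2 * a * ‖ξ‖)]

theorem memWeighted_of_hasCompactSupport (ha : 0 < a) {k : EuclideanSpace ℝ (Fin m) → Cliff m}
    (hk : Continuous k) (hkc : HasCompactSupport k) : MemWeighted a k := by
  have h1 : Continuous fun ξ => 2 * a * Real.exp (2 * a * ‖ξ‖) * ‖k ξ‖ ^ 2 := by fun_prop
  have h2 : HasCompactSupport fun ξ => 2 * a * Real.exp (2 * a * ‖ξ‖) * ‖k ξ‖ ^ 2 :=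
    HasCompactSupport.mul_left
      (hkc.comp_left (g := fun x : Cliff m => ‖x‖ ^ 2) (by simp))
  refine ⟨hk.aestronglyMeasurable, (h1.integrable_of_hasCompactSupport h2).mono'
    ((measurable_bergmanWeight a).aestronglyMeasurable.mul
      (hk.norm.pow 2).aestronglyMeasurable) (.of_forall fun ξ => ?_)⟩
  have hw := bergmanWeight_nonneg ha ξ
  rw [Real.norm_of_nonneg (by positivity)]
  gcongr
  exact bergmanWeight_le ha ξ

/-- Before the weighted bound is known, e(x,ξ)F(ξ) may grow exponentially; local integrability is
enough for testing against compactly supported φ. -/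
theorem locallyIntegrable_monoExp_mul {F : EuclideanSpace ℝ (Fin m) → Cliff m}
    (hF : MemLp F 2 volume) (x : ParaVec m) :
    LocallyIntegrable (fun ξ => monoExp x ξ * F ξ) volume := by
  have h1 : LocallyIntegrable F volume := hF.locallyIntegrable (by norm_num)
  have h2 : Continuous fun ξ : EuclideanSpace ℝ (Fin m) => 2 * Real.exp (|x.1| * ‖ξ‖) := by
    fun_prop
  have h3 : LocallyIntegrable (fun ξ => (2 * Real.exp (|x.1| * ‖ξ‖)) • F ξ) volume := by
    rw [← locallyIntegrableOn_univ] at h1 ⊢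
    exact h1.continuousOn_smul isOpen_univ.isLocallyClosed h2.continuousOn
  refine h3.mono ((stronglyMeasurable_monoExp_right x).aestronglyMeasurable.mul hF.1)
    (.of_forall fun ξ => (norm_monoExp_mul_le x ξ _).trans_eq ?_)
  rw [norm_smul, Real.norm_of_nonneg (by positivity)]

/-- Parseval's identity for a slice of `f` against a slice of a synthesized function. -/
theorem integral_inner_synth_slice [NeZero m] (ha : 0 < a) {t : ℝ} (ht : |t| < a)
    {F : EuclideanSpace ℝ (Fin m) → Cliff m} (hF : IsFourierL2 (fun y => f (t, y)) F)
    {φ : EuclideanSpace ℝ (Fin m) → ℝ} (hφ : Continuous φ) (hφc : HasCompactSupport φ)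
    (c : Cliff m) :
    ∫ y, inner ℂ (synth (fun ξ => φ ξ • c) (-t, y)) (f (t, y)) =
      (((2 * Real.pi) ^ m)⁻¹ : ℝ) • inner ℂ c (∫ ξ, φ ξ • (monoExp (-t, 0) ξ * F ξ)) := by
  have hk : MemWeighted a fun ξ => φ ξ • c :=
    memWeighted_of_hasCompactSupport ha (hφ.smul continuous_const) hφc.smul_right
  have h1 := (hk.isFourierL2_synth ha (t := -t) (by rwa [abs_neg])).integral_inner hF
  rw [h1]
  congr 1
  have hi : Integrable fun ξ => φ ξ • (monoExp (-t, 0) ξ * F ξ) :=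
    (locallyIntegrable_monoExp_mul hF.memLp_right _).integrable_smul_left_of_hasCompactSupport
      hφ hφc
  rw [← integral_inner hi]
  refine integral_congr_ae (.of_forall fun ξ => ?_)
  simp only [inner_monoExp_mul, ParaVec.conj, neg_zero]
  rw [← Complex.coe_smul, ← Complex.coe_smul, inner_smul_left, inner_smul_right,
    Complex.conj_ofReal]

/-- Conservation of the pairing with the function synthesized from φ(ξ)c, read through Parseval,
says that ∫ φ⟨c, e(-t,ξ)F_t⟩ does not depend on t; φ and c are arbitrary. -/
theorem MemBergman.monoExp_mul_fourier_ae_eq [NeZero m] (ha : 0 < a) (hf : MemBergman a f)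
    {s t : ℝ} (hs : |s| < a) (ht : |t| < a) {F G : EuclideanSpace ℝ (Fin m) → Cliff m}
    (hF : IsFourierL2 (fun y => f (s, y)) F) (hG : IsFourierL2 (fun y => f (t, y)) G) :
    (fun ξ => monoExp (-s, 0) ξ * F ξ) =ᵐ[volume] fun ξ => monoExp (-t, 0) ξ * G ξ := by
  refine ae_eq_of_integral_contDiff_smul_eq (locallyIntegrable_monoExp_mul hF.memLp_right _)
    (locallyIntegrable_monoExp_mul hG.memLp_right _) fun φ hφ hφc => ?_
  refine ext_inner_left ℂ fun c => ?_
  have hk : MemWeighted a fun ξ => φ ξ • c :=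
    memWeighted_of_hasCompactSupport ha (hφ.continuous.smul continuous_const) hφc.smul_right
  have hi : ∀ {t : ℝ} {G : EuclideanSpace ℝ (Fin m) → Cliff m}, |t| < a →
      IsFourierL2 (fun y => f (t, y)) G →
      Integrable fun y => inner ℂ (synth (fun ξ => φ ξ • c) (-t, y)) (f (t, y)) := by
    intro t G ht hG
    have h1 := (hk.isFourierL2_synth ha (t := -t) (by rwa [abs_neg])).memLp_left
    exact integrable_inner_of_norm_sq h1.1 hG.memLp_left.1 (integrable_norm_sq_of_memLp h1)
      (integrable_norm_sq_of_memLp hG.memLp_left)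
  have h := (hk.memBergman_synth ha).integral_inner_slice_eq hf hs ht (hi hs hF) (hi ht hG)
  rw [integral_inner_synth_slice ha hs hF hφ.continuous hφc,
    integral_inner_synth_slice ha ht hG hφ.continuous hφc] at h
  exact smul_right_injective ℂ (inv_ne_zero (by positivity : ((2 * Real.pi) ^ m) ≠ 0)) h

theorem MemBergman.ae_memLp_slice (hf : MemBergman a f) :
    ∀ᵐ t ∂(volume : Measure ℝ).restrict (Set.Ioo (-a) a), MemLp (fun y => f (t, y)) 2 volume := by
  have h1 := hf.2
  have h2 := hf.1.aestronglyMeasurable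
  rw [IntegrableOn, restrict_strip] at h1
  rw [restrict_strip] at h2
  filter_upwards [h1.prod_right_ae, h2.prodMk_left] with t ht ht'
  exact (memLp_two_iff_integrable_sq_norm ht').2 ht

theorem ae_eq_restrict_strip_of_slices {F G : ParaVec m → Cliff m}
    (hF : AEStronglyMeasurable F (volume.restrict (strip m a)))
    (hG : AEStronglyMeasurable G (volume.restrict (strip m a)))
    (h : ∀ᵐ t ∂(volume : Measure ℝ).restrict (Set.Ioo (-a) a),
      (fun y => F (t, y)) =ᵐ[volume] fun y => G (t, y)) :
    F =ᵐ[volume.restrict (strip m a)] G := by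
  rw [restrict_strip] at hF hG ⊢
  have hm : AEMeasurable (fun x => ‖F x - G x‖ₑ)
      ((volume.restrict (Set.Ioo (-a) a)).prod volume) := (hF.sub hG).enorm
  have h0 : ∫⁻ x, ‖F x - G x‖ₑ ∂((volume.restrict (Set.Ioo (-a) a)).prod volume) = 0 := by
    rw [lintegral_prod _ hm]
    refine lintegral_eq_zero_of_ae_eq_zero ?_
    filter_upwards [h] with t ht
    refine lintegral_eq_zero_of_ae_eq_zero ?_
    filter_upwards [ht] with y hy
    simp [hy]
  rw [lintegral_eq_zero_iff' hm] at h0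
  filter_upwards [h0] with x hx
  simpa [sub_eq_zero] using hx

/-- Every function in the Bergman space of the strip is synthesized from a weighted
square-integrable function. -/
theorem MemBergman.exists_eq_synth [NeZero m] (ha : 0 < a) (hf : MemBergman a f) :
    ∃ g : EuclideanSpace ℝ (Fin m) → Cliff m, MemWeighted a g ∧
      ∀ x ∈ strip m a, f x = synth g x := by
  have hne : (ae ((volume : Measure ℝ).restrict (Set.Ioo (-a) a))).NeBot := by
    rw [ae_restrict_neBot, Real.volume_Ioo]
    simp [ha]
  -- Fubini gives square-integrability of almost every slice only, so nothing is yet known about t =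
  -- 0. Some good slice s is transported to 0 by e(-s,ξ).
  obtain ⟨s, hs, hsa⟩ := (hf.ae_memLp_slice.and (ae_restrict_Ioo_abs_lt a)).exists
  obtain ⟨F, hF⟩ := IsFourierL2.exists_of_memLp hs
  set g := fun ξ => monoExp (-s, 0) ξ * F ξ
  have hgm : AEStronglyMeasurable g volume :=
    (stronglyMeasurable_monoExp_right _).aestronglyMeasurable.mul hF.memLp_right.1
  have hslice : ∀ᵐ t ∂(volume : Measure ℝ).restrict (Set.Ioo (-a) a),
      IsFourierL2 (fun y => f (t, y)) (fun ξ => monoExp (t, 0) ξ * g ξ) := by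
    filter_upwards [hf.ae_memLp_slice, ae_restrict_Ioo_abs_lt a] with t ht hta
    obtain ⟨G, hG⟩ := IsFourierL2.exists_of_memLp ht
    refine hG.congr_right ?_
    filter_upwards [hf.monoExp_mul_fourier_ae_eq ha hsa hta hF hG, ae_ne_zero] with ξ hξ hξ0
    have h0 : ((t, 0) + (-t, 0) : ParaVec m) = 0 := by ext <;> simp
    simp only [g, hξ]
    rw [← mul_assoc, monoExp_mul _ _ hξ0, h0, monoExp_zero, one_mul]
  have hg : MemWeighted a g := by
    refine memWeighted_of_lintegral_lt_top ha hgm ?_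
    have h1 := lintegral_strip_norm_sq ha hgm hf.1.aestronglyMeasurable hslice
    have h2 := h1 ▸ hf.2.lintegral_lt_top
    -- The norm identity read backwards: ‖f‖² is finite and (2π)^{-m} is positive, so the weighted
    -- integral of g cannot be infinite.
    refine lt_top_iff_ne_top.2 fun h => ?_
    rw [h, ENNReal.mul_top (by simp; positivity)] at h2
    exact lt_irrefl _ h2
  refine ⟨g, hg, ?_⟩
  have hsyn := hg.memBergman_synth ha
  -- Both sides are continuous on the open strip, so almost-everywhere equality of slices becomes
  -- equality at every point.
  refine Measure.eqOn_open_of_ae_eq (μ := volume) (ae_eq_restrict_strip_of_slices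
    hf.1.aestronglyMeasurable hsyn.1.aestronglyMeasurable ?_) (isOpen_strip m a)
    hf.1.1.continuousOn hsyn.1.1.continuousOn
  filter_upwards [hslice, hg.ae_isFourierL2_synth ha] with t h1 h2
  exact h1.ae_eq_left h2

theorem MemBergman.congr {F : ParaVec m → Cliff m} (hf : MemBergman a f)
    (h : ∀ x ∈ strip m a, F x = f x) : MemBergman a F :=
  ⟨hf.1.congr (isOpen_strip m a) h, hf.2.congr_fun (fun x hx => by simp only [h x hx])
    (isOpen_strip m a).measurableSet⟩

theorem MemWeighted.isFourierL2_of_eq_synth [NeZero m] (ha : 0 < a)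
    {g : EuclideanSpace ℝ (Fin m) → Cliff m} (hg : MemWeighted a g)
    (h : ∀ x ∈ strip m a, f x = synth g x) : IsFourierL2 (fun y => f (0, y)) g := by
  have h1 := hg.isFourierL2_synth ha (t := 0) (by simpa using ha)
  have h0 : ((0, 0) : ParaVec m) = 0 := rfl
  simp only [h0, monoExp_zero, one_mul] at h1
  have h2 : (fun y => f (0, y)) = fun y => synth g (0, y) :=
    funext fun y => h _ (by simpa [strip] using ha)
  rwa [h2]

theorem memBergman_iff_exists_fourier [NeZero m] (ha : 0 < a) (f : ParaVec m → Cliff m) :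
    MemBergman a f ↔
      ∃ g : EuclideanSpace ℝ (Fin m) → Cliff m,
        IsFourierL2 (fun y => f (0, y)) g ∧
        MemLp g 2 volume ∧
        Integrable (fun ξ => bergmanWeight a ξ * ‖g ξ‖ ^ 2) volume ∧
        ∀ x ∈ strip m a,
          Integrable (fun ξ => monoExp x ξ * g ξ) volume ∧
          f x = (((2 * Real.pi) ^ m)⁻¹ : ℝ) • ∫ ξ, monoExp x ξ * g ξ := by
  constructor
  · intro hf
    obtain ⟨g, hg, h⟩ := hf.exists_eq_synth ha
    exact ⟨g, hg.isFourierL2_of_eq_synth ha h, hg.memLp ha, hg.2, fun x hx =>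
      ⟨hg.integrable_monoExp_mul ha hx, h x hx⟩⟩
  · rintro ⟨g, -, hgm, hgi, h⟩
    have hg : MemWeighted a g := ⟨hgm.1, hgi⟩
    exact (hg.memBergman_synth ha).congr fun x hx => (h x hx).2

theorem MemBergman.normSq_eq [NeZero m] (ha : 0 < a) (hf : MemBergman a f)
    {g : EuclideanSpace ℝ (Fin m) → Cliff m} (hg : IsFourierL2 (fun y => f (0, y)) g) :
    ((2 * Real.pi) ^ m)⁻¹ * ∫ ξ, bergmanWeight a ξ * ‖g ξ‖ ^ 2 = bergmanNormSq a f := by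
  obtain ⟨k, hk, h⟩ := hf.exists_eq_synth ha
  have h1 : ∫ ξ, bergmanWeight a ξ * ‖g ξ‖ ^ 2 = ∫ ξ, bergmanWeight a ξ * ‖k ξ‖ ^ 2 :=
    integral_congr_ae (by
      filter_upwards [hg.ae_eq_right (hk.isFourierL2_of_eq_synth ha h)] with ξ hξ; rw [hξ])
  rw [h1, hk.bergmanNormSq_synth ha]
  exact setIntegral_congr_fun (isOpen_strip m a).measurableSet fun x hx => by
    simp only [h x hx]

end Analysis

/-! ### The reproducing kernel and its uniqueness. -/

section Kernel

open Cliff Filter Topology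

variable {m : ℕ} {a : ℝ}

/-- The spectrum of `w ↦ B(w, x̄) c`. -/
def kernelSpectrum (a : ℝ) (x : ParaVec m) (c : Cliff m) (ξ : EuclideanSpace ℝ (Fin m)) :
    Cliff m :=
  (bergmanWeight a ξ)⁻¹ • (monoExp x.conj ξ * c)

/-- One power of the weight cancels, leaving |e(x̄,ξ)c|² ≤ 4e^{2|x_0||ξ|}|c|² divided by the weight,
which decays exponentially because |x_0| < a. -/
theorem memWeighted_kernelSpectrum [NeZero m] (ha : 0 < a) {x : ParaVec m} (hx : x ∈ strip m a)
    (c : Cliff m) : MemWeighted a (kernelSpectrum a x c) := by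
  obtain ⟨C, hC, δ, hδ, h⟩ := exists_exp_le_bergmanWeight (m := m) ha hx
  have hm : AEStronglyMeasurable (kernelSpectrum a x c) volume :=
    (measurable_bergmanWeight a).inv.aestronglyMeasurable.smul
      ((stronglyMeasurable_monoExp_right x.conj).aestronglyMeasurable.mul
        aestronglyMeasurable_const)
  refine ⟨hm, ((integrable_exp_neg_mul_norm (m := m) hδ).const_mul (4 * C * ‖c‖ ^ 2)).mono'
    ((measurable_bergmanWeight a).aestronglyMeasurable.mul (hm.norm.pow 2)) ?_⟩
  filter_upwards [ae_ne_zero] with ξ hξ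
  have hw := bergmanWeight_pos ha hξ
  rw [Real.norm_of_nonneg (by positivity), kernelSpectrum, norm_smul,
    Real.norm_of_nonneg (inv_nonneg.2 hw.le)]
  have h1 := norm_monoExp_mul_le x.conj ξ c
  have h2 : Real.exp (2 * |x.1| * ‖ξ‖) = Real.exp (|x.1| * ‖ξ‖) ^ 2 := by
    rw [← Real.exp_nat_mul]; congr 1; push_cast; ring
  have h3 := h ξ hξ
  calc bergmanWeight a ξ * ((bergmanWeight a ξ)⁻¹ * ‖monoExp x.conj ξ * c‖) ^ 2
      = (bergmanWeight a ξ)⁻¹ * ‖monoExp x.conj ξ * c‖ ^ 2 := by field_simp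
    _ ≤ (bergmanWeight a ξ)⁻¹ * (2 * Real.exp (|x.1| * ‖ξ‖) * ‖c‖) ^ 2 := by gcongr; exact h1
    _ = 4 * ‖c‖ ^ 2 * ((bergmanWeight a ξ)⁻¹ * Real.exp (2 * |x.1| * ‖ξ‖)) := by rw [h2]; ring
    _ ≤ 4 * ‖c‖ ^ 2 * ((bergmanWeight a ξ)⁻¹ *
          (C * (bergmanWeight a ξ * Real.exp (-(δ * ‖ξ‖))))) := by gcongr
    _ = 4 * C * ‖c‖ ^ 2 * Real.exp (-(δ * ‖ξ‖)) := by field_simp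

theorem monoExp_mul_kernelSpectrum (w x : ParaVec m) (c : Cliff m) {ξ : EuclideanSpace ℝ (Fin m)}
    (hξ : ξ ≠ 0) :
    monoExp w ξ * kernelSpectrum a x c ξ = bergmanKernelIntegrand a w x ξ * c := by
  rw [kernelSpectrum, bergmanKernelIntegrand, bergmanWeight_inv, ← Complex.coe_smul,
    ← Complex.coe_smul, mul_smul_comm, ← mul_assoc, monoExp_mul _ _ hξ, smul_mul_assoc]

theorem integrable_bergmanKernelIntegrand [NeZero m] (ha : 0 < a) {w x : ParaVec m}
    (hw : w ∈ strip m a) (hx : x ∈ strip m a) :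
    Integrable (bergmanKernelIntegrand a w x) volume := by
  refine ((memWeighted_kernelSpectrum ha hx 1).integrable_monoExp_mul ha hw).congr ?_
  filter_upwards [ae_ne_zero] with ξ hξ
  rw [monoExp_mul_kernelSpectrum w x 1 hξ, mul_one]

/-- The right factor c makes the Clifford-valued reproducing formula testable by scalar inner
products with arbitrary c. -/
theorem bergmanKernel_mul [NeZero m] (ha : 0 < a) {w x : ParaVec m}
    (hw : w ∈ strip m a) (hx : x ∈ strip m a) (c : Cliff m) :
    bergmanKernel a w x * c = synth (kernelSpectrum a x c) w := by
  have h := ((mulL m).flip c).integral_comp_comm (integrable_bergmanKernelIntegrand ha hw hx)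
  simp only [ContinuousLinearMap.flip_apply, mulL_apply] at h
  rw [bergmanKernel, synth, ← Complex.coe_smul, ← Complex.coe_smul, smul_mul_assoc, ← h]
  congr 1
  refine integral_congr_ae ?_
  filter_upwards [ae_ne_zero] with ξ hξ
  rw [monoExp_mul_kernelSpectrum w x c hξ]

theorem memBergman_bergmanKernel [NeZero m] (ha : 0 < a) {x : ParaVec m} (hx : x ∈ strip m a) :
    MemBergman a fun w => bergmanKernel a w x :=
  ((memWeighted_kernelSpectrum ha hx 1).memBergman_synth ha).congr fun w hw => by
    rw [← bergmanKernel_mul ha hw hx, mul_one]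

theorem MemBergman.integrableOn_star_mul {h f : ParaVec m → Cliff m} (hh : MemBergman a h)
    (hf : MemBergman a f) : IntegrableOn (fun w => star (h w) * f w) (strip m a) volume := by
  have h1 : AEStronglyMeasurable (fun w => star (h w)) (volume.restrict (strip m a)) :=
    (starL m).continuous.comp_aestronglyMeasurable hh.1.aestronglyMeasurable
  refine ((hh.2.add hf.2).const_mul ‖mulL m‖).mono'
    (h1.mul hf.1.aestronglyMeasurable) (.of_forall fun w => ?_)
  refine ((mulL m).le_opNorm₂ (star (h w)) (f w)).trans ?_
  rw [norm_star, mul_assoc, Pi.add_apply]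
  gcongr
  nlinarith [sq_nonneg (‖h w‖ - ‖f w‖), sq_nonneg (‖h w‖ + ‖f w‖)]

theorem isBergmanKernel_bergmanKernel [NeZero m] (ha : 0 < a) :
    IsBergmanKernel a (bergmanKernel (m := m) a) := by
  intro x hx
  refine ⟨memBergman_bergmanKernel ha hx, fun f hf => ?_⟩
  have hi := (memBergman_bergmanKernel ha hx).integrableOn_star_mul hf
  refine ⟨hi, ext_inner_left ℂ fun c => ?_⟩
  obtain ⟨g, hg, hfg⟩ := hf.exists_eq_synth ha
  have hk := memWeighted_kernelSpectrum ha hx c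
  -- Moving star B across the inner product places B·c, a synthesized function, in the first slot,
  -- where the polarized norm identity applies.
  have h1 : ∫ w in strip m a, inner ℂ c (star (bergmanKernel a w x) * f w) =
      ∫ w in strip m a, inner ℂ (synth (kernelSpectrum a x c) w) (synth g w) :=
    setIntegral_congr_fun (isOpen_strip m a).measurableSet fun w hw => by
      simp only [inner_mul_right, star_star, bergmanKernel_mul ha hw hx, hfg w hw]
  rw [← integral_inner hi, h1, hg.integral_inner_synth hk ha, hfg x hx, synth, ← Complex.coe_smul,
    inner_smul_right, ← integral_inner (hg.integrable_monoExp_mul ha hx), Complex.real_smul]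
  congr 1
  refine integral_congr_ae ?_
  filter_upwards [ae_ne_zero] with ξ hξ
  have hw : (bergmanWeight a ξ : ℂ) ≠ 0 := by exact_mod_cast (bergmanWeight_pos ha hξ).ne'
  have hc : x.conj.conj = x := by simp [ParaVec.conj]
  rw [kernelSpectrum, ← Complex.coe_smul, inner_smul_left, Complex.conj_ofReal, Complex.ofReal_inv,
    mul_inv_cancel_left₀ hw, inner_monoExp_mul, hc]

/-- Reproduce K(·,x) with L at w and L(·,w) with K at x: the two integrals are conjugate. With L the
Bergman kernel, applied to K and to the kernel itself, this gives uniqueness. -/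
theorem IsBergmanKernel.eq_star {K L : ParaVec m → ParaVec m → Cliff m}
    (hK : IsBergmanKernel a K) (hL : IsBergmanKernel a L) {w x : ParaVec m}
    (hw : w ∈ strip m a) (hx : x ∈ strip m a) : K w x = star (L x w) := by
  obtain ⟨-, h1⟩ := (hL w hw).2 _ (hK x hx).1
  obtain ⟨h2i, h2⟩ := (hK x hx).2 _ (hL w hw).1
  have h3 := (starL m).integral_comp_comm h2i
  simp only [Cliff.starL_apply, star_mul, star_star] at h3
  rw [h2, ← h3, h1]

end Kernel

end

theorem theorem3p3 (m : ℕ) (hm : 1 ≤ m) (a : ℝ) (ha : 0 < a) :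
    -- the spectrum characterization
    (∀ f : ParaVec m → Cliff m,
      MemBergman a f ↔
        ∃ g : EuclideanSpace ℝ (Fin m) → Cliff m,
          IsFourierL2 (fun y => f (0, y)) g ∧
          MemLp g 2 volume ∧
          Integrable (fun ξ => bergmanWeight a ξ * ‖g ξ‖ ^ 2) volume ∧
          ∀ x ∈ strip m a,
            Integrable (fun ξ => monoExp x ξ * g ξ) volume ∧
            f x = (((2 * Real.pi) ^ m)⁻¹ : ℝ) • ∫ ξ, monoExp x ξ * g ξ) ∧
    -- the norm identity
    (∀ f : ParaVec m → Cliff m, MemBergman a f →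
      ∀ g : EuclideanSpace ℝ (Fin m) → Cliff m, IsFourierL2 (fun y => f (0, y)) g →
        ((2 * Real.pi) ^ m)⁻¹ * ∫ ξ, bergmanWeight a ξ * ‖g ξ‖ ^ 2 = bergmanNormSq a f) ∧
    -- the Bergman kernel: the integral converges, and it is the reproducing kernel
    (∀ w ∈ strip m a, ∀ x ∈ strip m a,
      Integrable (bergmanKernelIntegrand a w x) volume) ∧
    IsBergmanKernel a (bergmanKernel (m := m) a) ∧
    (∀ K : ParaVec m → ParaVec m → Cliff m, IsBergmanKernel a K →
      ∀ w ∈ strip m a, ∀ x ∈ strip m a, K w x = bergmanKernel a w x) := by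
  have : NeZero m := ⟨by omega⟩
  have hB := isBergmanKernel_bergmanKernel (m := m) ha
  exact ⟨memBergman_iff_exists_fourier ha, fun f hf g hg => hf.normSq_eq ha hg,
    fun w hw x hx => integrable_bergmanKernelIntegrand ha hw hx, hB,
    fun K hK w hw x hx => (hK.eq_star hB hw hx).trans (hB.eq_star hB hw hx).symm⟩
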